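/- **Setting.** Let $G=(V,E)$ be a finite connected (simple, undirected) graph with maximal degree $\Delta\ge 2$, and let $B\subset A\subset V$ be such that no two sites of $B$ are neighbours and every site of $B$ has degree at least $2$ in $G$. *$A$-stabilisation of the stochastic sandpile (SSM).* Let $(\tau^{x,j})_{x\in V,\,j\ge 1}$ be independent random instructions, where $\tau^{x,j}$ is a uniformly chosen neighbour of $x$. Half-toppling an occupied site $x$ for the $j$-th time moves one particle from $x$ to $\tau^{x,j}$. A site $x\in A$ is $A$-stable if it is empty, or if it contains exactly one particle and has been half-toppled an even number of times so far; a site $x\in V\setminus A$ is $A$-stable if it is empty; otherwise the site is $A$-unstable. For $\eta\in\mathbb N_0^V$, a finite sequence of sites, half-toppled successively from $\eta$ (with no previous half-toppling), is $A$-legal if each of its sites is $A$-unstable just before it is half-toppled. Let $m^A_\eta(x)\in\mathbb N_0\cup\{\infty\}$ be the supremum, over all $A$-legal sequences, of the number of occurrences of $x$, and let $\|m^A_\eta\|=\sum_{x\in V}m^A_\eta(x)$ be the number of half-topplings needed to $A$-stabilise $\eta$. *Activated random walks with instantaneous deactivation (ARWD) on $B$.* A configuration is an element of $\mathbb N_{\mathfrak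 s}^V$ with $\mathbb N_{\mathfrak s}=\mathbb N_0\cup\{\mathfrak s\}$, where $k\in\mathbb N_0$ stands for $k$ active particles and $\mathfrak s$ for one sleeping particle; a site is unstable if it contains at least one active particle. A toppling strategy is a function $f$ which maps each finite history $(\eta_0,\dots,\eta_t)$ of configurations either to a site that is unstable in $\eta_t$ or to $\varnothing$. Given $\lambda\ge 0$ and an initial configuration with exactly $|B|$ particles, $\mathrm{ARWD}(\lambda,B,f,\eta_0)$ is the process $(\eta_t)_{t\ge 0}$ which, given $\eta_0,\dots,\eta_t$, evolves as follows. If $f(\eta_0,\dots,\eta_t)=\varnothing$ then $\eta_{t+1}=\eta_t$. If $f(\eta_0,\dots,\eta_t)=x\in V$, let $p=\lambda/(1+\lambda)$ if $x\in B$ and $\eta_t(x)=1$, and $p=0$ otherwise. With probability $p$, the particle at $x$ falls asleep, i.e. $\eta_{t+1}$ is obtained from $\eta_t$ by setting the value at $x$ to $\mathfrak s$. With probability $1-p$, one particle at $x$ performs a simple random walk $X$ on $G$ with $X(0)=x$ until the first time $\sigma\ge 1$ at which $X(\sigma)$ is a site of $B$ that is empty in $\eta_t-\mathbf 1_x$;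 it is left there, sleeping, and every sleeping particle on a site of $\{X(0),\dots,X(\sigma-1)\}$ becomes active. Let $T(B,f,\eta_0)=\inf\{t\ge 0: f(\eta_0,\dots,\eta_t)=\varnothing\}\in\mathbb N_0\cup\{\infty\}$. **Proposition.** Let $\eta\in\mathbb N_0^V$ with $\sum_{x\in V}\eta(x)=|A|$, let $U=\{x\in A:\eta(x)\ge 2\}$ and $\tilde\eta=\mathbf 1_U+\mathfrak s\,\mathbf 1_{A\setminus U}$, and let $\lambda=\Delta^3$. Then for every toppling strategy $f$, the random variable $\|m^A_\eta\|$ stochastically dominates $T(B,f,\tilde\eta\,\mathbf 1_B)$, i.e. $$\mathbb P\big(T(B,f,\tilde\eta\,\mathbf 1_B)\ge k\big)\le \mathbb P\big(\|m^A_\eta\|\ge k\big)\qquad\text{for every } k\in\mathbb N_0\cup\{\infty\}.$$ -/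

import Mathlib

open MeasureTheory ProbabilityTheory
open scoped ENNReal NNReal

noncomputable section

namespace Sandpile

variable {V : Type*} [Fintype V] [DecidableEq V]

/-! ### One step of the simple random walk -/

section Jump

variable (G : SimpleGraph V) [DecidableRel G.Adj]

/-- The law of one jump from `x`: a uniformly chosen neighbour of `x`. (A site without neighbours,
which does not exist in a connected graph with at least two sites, keeps its particle.) -/
def jumpPMF (x : V) : PMF V :=
  if h : (G.neighborFinset x).Nonempty then PMF.uniformOfFinset (G.neighborFinset x) h
  else PMF.pure x

end Jump

/-! ### The stochastic sandpile model and its `A`-stabilisation by half-topplings -/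

section SSM

/-- State of a sandpile in the course of half-topplings: `state.1 x` is the number of particles
at `x`, and `state.2 x` is the number of half-topplings already made at `x`, i.e. twice the
odometer `h x ∈ (1/2) ℕ` in which each half-toppling counts for `1/2`. -/
abbrev SSMState (V : Type*) := (V → ℕ) × (V → ℕ)

/-- Half-toppling of `x`: one particle at `x` follows the first unused instruction at `x`.
Here `τ (x, j)` is the target of the instruction number `j` at `x`, `j = 0, 1, 2, …`. -/
def halfTopple (τ : V × ℕ → V) (x : V) (s : SSMState V) : SSMState V :=
  (s.1 - Pi.single x 1 + Pi.single (τ (x, s.2 x)) 1, s.2 + Pi.single x 1)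

/-- A site of `A` is `A`-stable if it is empty, or if it has one particle and has been
half-toppled an even number of times; a site outside `A` is `A`-stable if it is empty. -/
def AStable (A : Finset V) (s : SSMState V) (x : V) : Prop :=
  s.1 x = 0 ∨ (x ∈ A ∧ s.1 x = 1 ∧ Even (s.2 x))

/-- `α` is an `A`-legal sequence of half-topplings from the state `s`: each site of the sequence
is `A`-unstable (in particular, occupied) at the moment when it is half-toppled. -/
def ALegal (τ : V × ℕ → V) (A : Finset V) : SSMState V → List V → Prop
  | _, [] => True
  | s, x :: α => ¬ AStable A s x ∧ ALegal τ A (halfTopple τ x s) α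

/-- The odometer `m^A_η` of the `A`-stabilisation of `η`: at each site, the supremum of the number
of occurrences of that site over all `A`-legal sequences for `(η, 0)`. -/
def odometer (τ : V × ℕ → V) (A : Finset V) (η : V → ℕ) (x : V) : ℕ∞ :=
  ⨆ (α : List V) (_ : ALegal τ A (η, 0) α), (α.count x : ℕ∞)

/-- `‖m^A_η‖`, the number of half-topplings needed to `A`-stabilise `η`. -/
def numHalfTopplings (A : Finset V) (η : V → ℕ) (τ : V × ℕ → V) : ℕ∞ :=
  ∑ x, odometer τ A η x

/-- The law of the field of instructions: independent instructions, the ones at `x` being jumps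
to uniformly chosen neighbours of `x`. -/
def instructionLaw [MeasurableSpace V] (G : SimpleGraph V) [DecidableRel G.Adj] :
    Measure (V × ℕ → V) :=
  Measure.infinitePi fun p : V × ℕ => (jumpPMF G p.1).toMeasure

end SSM

/-! ### Simple random walk -/

section Walk

variable [MeasurableSpace V] [DiscreteMeasurableSpace V]
variable (G : SimpleGraph V) [DecidableRel G.Adj]

/-- The law of `X (t + 1)` given `X 0, …, X t` for the simple random walk. -/
def walkKernel (t : ℕ) : Kernel ((_i : Finset.Iic t) → V) V :=
  Kernel.ofFunOfCountable fun h => (jumpPMF G (h ⟨t, Finset.mem_Iic.2 le_rfl⟩)).toMeasure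

instance (t : ℕ) : IsMarkovKernel (walkKernel G t) :=
  ⟨fun h => PMF.toMeasure.isProbabilityMeasure
    (jumpPMF G (h ⟨t, Finset.mem_Iic.2 le_rfl⟩))⟩

/-- The law `P_x` of the simple random walk `(X t)_{t ≥ 0}` on `G` started at `x`. -/
def walkLaw (x : V) : Measure (ℕ → V) :=
  Kernel.traj (X := fun _ => V) (walkKernel G) 0 fun _ => x

instance (x : V) : IsProbabilityMeasure (walkLaw G x) := by
  unfold walkLaw; infer_instance

end Walk

/-! ### Configurations with active and sleeping particles -/

/-- Content of a site: `act k` stands for `k` active particles (`act 0` is an empty site),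
`slp` for one sleeping particle. -/
inductive SiteState : Type
  | act (k : ℕ) : SiteState
  | slp : SiteState

namespace SiteState

instance : Countable SiteState :=
  Function.Injective.countable
    (f := fun s : SiteState => match s with | act k => k + 1 | slp => 0) (by
      intro a b h
      cases a <;> cases b <;> simp_all)

instance : MeasurableSpace SiteState := ⊤

/-- Number of particles, a sleeping particle counting for one. -/
def card : SiteState → ℕ
  | act k => k
  | slp => 1

/-- Removal of one active particle (only used when there is one). -/
def pred : SiteState → SiteState
  | act k => act (k - 1)
  | slp => slp

/-- A site is unstable if it contains at least one active particle. -/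
def Unstable (s : SiteState) : Prop := s ≠ act 0 ∧ s ≠ slp

end SiteState

open SiteState

/-- Configurations with active and sleeping particles. -/
abbrev Config (V : Type*) := V → SiteState

/-- The total number of particles. -/
def Config.card (η : Config V) : ℕ := ∑ x, (η x).card

open Classical in
/-- The configuration obtained from `η` by waking up the sleeping particles in `R`. -/
def Config.wake (η : Config V) (R : Set V) : Config V :=
  fun z => if z ∈ R ∧ η z = slp then act 1 else η z

/-! ### Activated random walks with instantaneous deactivation (ARWD) -/

section Strategy

/-- A toppling strategy: given the history `η₀, …, η_t` it returns a site which is unstable in `η_t`,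
or `none`. -/
structure Strategy (V : Type*) where
  choose : (t : ℕ) → ((_i : Finset.Iic t) → Config V) → Option V
  unstable : ∀ (t : ℕ) (h : (_i : Finset.Iic t) → Config V) (x : V), choose t h = some x →
    (h ⟨t, Finset.mem_Iic.2 le_rfl⟩ x).Unstable

/-- The first time (possibly infinite) at which the strategy returns `none`. -/
def stabTime (f : Strategy V) (ω : ℕ → Config V) : ℕ∞ :=
  ⨅ (t : ℕ) (_ : f.choose t (fun i => ω i) = none), (t : ℕ∞)

end Strategy

section ARWD

/-- The set of the sites of `A` which are empty once one particle has been removed from `x`. -/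
def emptySites (A : Finset V) (η : Config V) (x : V) : Set V :=
  {z | z ∈ A ∧ Function.update η x (η x).pred z = act 0}

/-- The configuration `η^R - 1_x + 𝔰 1_y` obtained when the walk `X`, started at `x`, makes its first
return at time `n ≥ 1` to the set of empty sites, where `y = X n` and where `R` is the set of sites
visited before time `n` (among which those with a sleeping particle are woken up). -/
def afterWalk (η : Config V) (x : V) (n : ℕ) (X : ℕ → V) : Config V :=
  let η₁ := η.wake {z | ∃ t < n, X t = z}
  Function.update (Function.update η₁ x (η₁ x).pred) (X n) slp

open Classical in
/-- The configuration obtained from `η` when a particle at `x` follows the trajectory `X` until the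
first time `n ≥ 1` at which it is on an empty site of `A`. (If there is no such time, which has
probability zero for the configurations with `A.card` particles, the configuration is unchanged.) -/
def walkResult (A : Finset V) (η : Config V) (x : V) (X : ℕ → V) : Config V :=
  if h : ∃ n, 1 ≤ n ∧ X n ∈ emptySites A η x then afterWalk η x (Nat.find h) X else η

open Classical in
/-- The probability that the particle chosen at `x` falls asleep instead of walking. -/
def sleepProb (lam : ℝ≥0) (A : Finset V) (η : Config V) (x : V) : ℝ≥0 :=
  if x ∈ A ∧ η x = act 1 then lam / (1 + lam) else 0

set_option linter.unusedSectionVars false in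
theorem sleepProb_le_one (lam : ℝ≥0) (A : Finset V) (η : Config V) (x : V) :
    sleepProb lam A η x ≤ 1 := by
  unfold sleepProb
  split_ifs
  · exact div_le_one_of_le₀ (by simp) (by positivity)
  · exact zero_le_one

variable [MeasurableSpace V] [DiscreteMeasurableSpace V]

theorem measurable_afterWalk (η : Config V) (x : V) (n : ℕ) :
    Measurable (afterWalk η x n) := by
  let g : ((Finset.range (n + 1)) → V) → Config V := fun Y =>
    afterWalk η x n fun t => if h : t ∈ Finset.range (n + 1) then Y ⟨t, h⟩ else x
  have hg : Measurable g := measurable_of_countable g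
  have h2 : afterWalk η x n = g ∘ fun X i => X i := by
    funext X
    have h3 : {z | ∃ t < n, X t = z} = {z | ∃ t < n,
        (if t ∈ Finset.range (n + 1) then X t else x) = z} := by
      ext z
      refine exists_congr fun t => and_congr_right fun ht => ?_
      rw [if_pos (Finset.mem_range.2 (by omega))]
    simp [g, afterWalk, h3]
  rw [h2]
  exact hg.comp (by fun_prop)

theorem measurable_walkResult (A : Finset V) (η : Config V) (x : V) :
    Measurable (walkResult A η x) := by
  classical
  let p : (ℕ → V) → ℕ → Prop := fun X n => 1 ≤ n ∧ X n ∈ emptySites A η x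
  have hp : ∀ n, MeasurableSet {X | p X n} := fun n =>
    (MeasurableSet.const (1 ≤ n)).inter
      ((measurable_pi_apply n : Measurable fun X : ℕ → V => X n)
        (MeasurableSet.of_discrete (s := emptySites A η x)))
  have hE : MeasurableSet {X | ∃ n, p X n} := by
    have : {X | ∃ n, p X n} = ⋃ n, {X | p X n} := by ext; simp
    rw [this]
    exact MeasurableSet.iUnion hp
  let q : (ℕ → V) → ℕ → Prop := fun X n => p X n ∨ ¬ ∃ n, p X n
  have hq : ∀ n, MeasurableSet {X | q X n} := fun n => (hp n).union hE.compl
  have hex : ∀ X, ∃ n, q X n := fun X => by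
    by_cases h : ∃ n, p X n
    · exact h.imp fun n hn => Or.inl hn
    · exact ⟨0, Or.inr h⟩
  have h1 := Measurable.find (fun n => measurable_afterWalk η x n) hq hex
  have h2 : Measurable fun X =>
      if ∃ n, p X n then afterWalk η x (Nat.find (hex X)) X else η :=
    Measurable.ite hE h1 measurable_const
  convert h2 using 1
  funext X
  by_cases h : ∃ n, p X n
  · have h' : ∃ n, 1 ≤ n ∧ X n ∈ emptySites A η x := h
    have e : Nat.find h' = Nat.find (hex X) :=
      Nat.find_congr' fun {n} => by simp [q, h, p]
    rw [walkResult, dif_pos h', if_pos h, e]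
  · have h' : ¬ ∃ n, 1 ≤ n ∧ X n ∈ emptySites A η x := h
    rw [walkResult, dif_neg h', if_neg h]

variable (G : SimpleGraph V) [DecidableRel G.Adj]

/-- The law of the next configuration when the site `x` is chosen in the configuration `η`: with
probability `p` the particle falls asleep, with probability `1 - p` it performs a walk. -/
def toppleLaw (lam : ℝ≥0) (A : Finset V) (η : Config V) (x : V) : Measure (Config V) :=
  sleepProb lam A η x • Measure.dirac (Function.update η x slp) +
    (1 - sleepProb lam A η x) • (walkLaw G x).map (walkResult A η x)

/-- The transition law `Q_A(η, x, ·)`, where `x` is a site or `none`. -/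
def stepLaw (lam : ℝ≥0) (A : Finset V) (η : Config V) : Option V → Measure (Config V)
  | none => Measure.dirac η
  | some x => toppleLaw G lam A η x

instance (lam : ℝ≥0) (A : Finset V) (η : Config V) (o : Option V) :
    IsProbabilityMeasure (stepLaw G lam A η o) := by
  cases o with
  | none => unfold stepLaw; infer_instance
  | some x =>
    have := Measure.isProbabilityMeasure_map (μ := walkLaw G x)
      (measurable_walkResult A η x).aemeasurable
    constructor
    simp only [stepLaw, toppleLaw, Measure.add_apply, Measure.smul_apply, measure_univ]
    rw [ENNReal.smul_def, ENNReal.smul_def, smul_eq_mul, smul_eq_mul, mul_one, mul_one,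
      ← ENNReal.coe_add, add_tsub_cancel_of_le (sleepProb_le_one lam A η x), ENNReal.coe_one]

/-- The law of `η_{t+1}` given the history `η₀, …, η_t` of the process. -/
def arwdKernel (lam : ℝ≥0) (A : Finset V) (f : Strategy V) (t : ℕ) :
    Kernel ((_i : Finset.Iic t) → Config V) (Config V) :=
  Kernel.ofFunOfCountable fun h =>
    stepLaw G lam A (h ⟨t, Finset.mem_Iic.2 le_rfl⟩) (f.choose t h)

instance (lam : ℝ≥0) (A : Finset V) (f : Strategy V) (t : ℕ) :
    IsMarkovKernel (arwdKernel G lam A f t) :=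
  ⟨fun h => inferInstanceAs (IsProbabilityMeasure
    (stepLaw G lam A (h ⟨t, Finset.mem_Iic.2 le_rfl⟩) (f.choose t h)))⟩

/-- The law of the process `ARWD(lam, A, f, η₀)`. It is meant for initial configurations with
`A.card` particles, and then lives on the configurations with `A.card` particles. -/
def arwdLaw (lam : ℝ≥0) (A : Finset V) (f : Strategy V) (η₀ : Config V) :
    Measure (ℕ → Config V) :=
  Kernel.traj (X := fun _ => Config V) (arwdKernel G lam A f) 0 fun _ => η₀

instance (lam : ℝ≥0) (A : Finset V) (f : Strategy V) (η₀ : Config V) :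
    IsProbabilityMeasure (arwdLaw G lam A f η₀) := by
  unfold arwdLaw; infer_instance

end ARWD

/-! ### The comparison -/

/-- The configuration `𝟙_U + 𝔰 𝟙_{A ∖ U}` with `U = {x ∈ A | η x ≥ 2}`. -/
def inducedConfig (A : Finset V) (η : V → ℕ) : Config V :=
  fun x => if x ∈ A then (if 2 ≤ η x then act 1 else slp) else act 0

/-- The restriction `η 𝟙_B`, empty outside `B`. -/
def Config.restrict (η : Config V) (B : Finset V) : Config V :=
  fun x => if x ∈ B then η x else act 0

/-- The configuration `(𝟙_U + 𝔰 𝟙_{A ∖ U}) 𝟙_B` has `B.card` particles, as is required of an initial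
configuration of ARWD on `B`. -/
theorem card_restrict_inducedConfig {A B : Finset V} (hBA : B ⊆ A) (η : V → ℕ) :
    ((inducedConfig A η).restrict B).card = B.card := by
  have h : ∀ x, ((inducedConfig A η).restrict B x).card = if x ∈ B then 1 else 0 := by
    intro x
    by_cases hx : x ∈ B
    · by_cases h2 : 2 ≤ η x <;>
        simp [Config.restrict, inducedConfig, hx, hBA hx, h2, SiteState.card]
    · simp [Config.restrict, hx, SiteState.card]
  simp [Config.card, h]

/-- `X` (under `P`) stochastically dominates `Y` (under `Q`). -/
def StochDominates {Ω Ω' : Type*} [MeasurableSpace Ω] [MeasurableSpace Ω']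
    (P : Measure Ω) (X : Ω → ℕ∞) (Q : Measure Ω') (Y : Ω' → ℕ∞) : Prop :=
  ∀ k : ℕ∞, Q {ω | k ≤ Y ω} ≤ P {ω | k ≤ X ω}

end Sandpile

end

/-! Legal half-topplings may be chosen adaptively, so it suffices to play well a game in which any
surely unstable site may be toppled. Its value `gameVal` depends only on the particles and on the
parities on `B`, and bounds from below the probability of a long legal sequence
(`gameVal_le_measure_legalSet`).

ARWD is encoded by the sandpile with one particle per site of `A` and independent random parities on
`B`, odd with probability at least `1 / (1 + lam)` on the set `S` of active sites (`IsParityLaw`).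
When the strategy picks `x ∈ S`, an even parity is matched with falling asleep, at no cost; if the
parity is odd, `x` is half-toppled and its particle is moved until it returns to `x`
(`survival_le_avg_gameVal`).

Whenever this particle meets another site `y` of `B`, there are two particles at `y`, and loops `y →
z → y` of probability at least `Δ⁻²` flip the parity at `y`. Stopping to keep track of it after two
loops makes the parity on departure random enough, whatever it was before and whatever the exit site
(`le_avg_gameVal_of_loop`, `excursion_le_avg_gameVal`).

The count is exact because of the budget `k - S.card`: with `k` ARWD steps to go, only that many
half-topplings are required. Falling asleep lowers `k` and `S.card` together, and waking a site is
paid for by a half-toppling there. From `η`, one half-toppling at each site of `B` with two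
particles or more pays for the initial active set, after which the sandpile is levelled to one
particle per site of `A` (`le_avg_gameVal_of_card`). -/

noncomputable section

namespace Sandpile

/-! ### Trajectories of a sequence of kernels -/

section Traj

open Finset Preorder Kernel

variable {E : Type*} [MeasurableSpace E] (κ : (t : ℕ) → Kernel ((_i : Finset.Iic t) → E) E)
  [∀ t, IsMarkovKernel (κ t)]

/-- The law of the trajectories continuing the history of `ω` up to time `t`. -/
def trajFrom (t : ℕ) (ω : ℕ → E) : Measure (ℕ → E) :=
  Kernel.traj (X := fun _ => E) κ t (frestrictLe t ω)

instance (t : ℕ) (ω : ℕ → E) : IsProbabilityMeasure (trajFrom κ t ω) := by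
  unfold trajFrom; infer_instance

/-- One-step Markov property, used to unroll both the walk and ARWD. Only the values of `ω` up to
time `t` matter, so `Function.update` just appends `y` to the history. -/
theorem lintegral_trajFrom_succ (t : ℕ) (ω : ℕ → E) {F : (ℕ → E) → ℝ≥0∞} (hF : Measurable F) :
    ∫⁻ X, F X ∂trajFrom κ t ω =
      ∫⁻ y, ∫⁻ X, F X ∂trajFrom κ (t + 1) (Function.update ω (t + 1) y)
        ∂κ t (frestrictLe t ω) := by
  have hΦ : Measurable fun ω' : ℕ → E =>
      ∫⁻ X, F X ∂Kernel.traj (X := fun _ => E) κ (t + 1) (frestrictLe (t + 1) ω') :=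
    (hF.lintegral_kernel (κ := Kernel.traj (X := fun _ => E) κ (t + 1))).comp
      (measurable_frestrictLe _)
  have h := lmarginalPartialTraj_succ (X := fun _ => E) (κ := κ) t hΦ ω
  unfold trajFrom
  rw [← h, lmarginalPartialTraj]
  simp_rw [frestrictLe_updateFinset]
  rw [← Kernel.lintegral_comp _ _ _ hF, Kernel.traj_comp_partialTraj (Nat.le_succ t)]

theorem ae_trajFrom (t : ℕ) (ω : ℕ → E) [Countable E] [MeasurableSingletonClass E] :
    ∀ᵐ X ∂trajFrom κ t ω, ∀ i ≤ t, X i = ω i := by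
  unfold trajFrom
  rw [← Kernel.traj_map_updateFinset]
  rw [ae_map_iff]
  · refine ae_of_all _ fun X i hi => ?_
    simp [Function.updateFinset, hi]
  · exact measurable_updateFinset_left.aemeasurable
  · have : {X : ℕ → E | ∀ i ≤ t, X i = ω i} = ⋂ i, ⋂ (_ : i ≤ t), {X | X i = ω i} := by
      ext; simp
    rw [this]
    exact MeasurableSet.iInter fun i => MeasurableSet.iInter fun _ =>
      (measurable_pi_apply i) (measurableSet_singleton _)

end Traj

end Sandpile

namespace Sandpile

variable {V : Type*} [DecidableEq V]

/-! ### A toppling game on the sandpile -/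

/-- The configuration obtained from `c` by moving a particle from `x` to `z`. -/
def move (c : V → ℕ) (x z : V) : V → ℕ := c - Pi.single x 1 + Pi.single z 1

theorem move_apply (c : V → ℕ) (x z y : V) :
    move c x z y = c y - (if y = x then 1 else 0) + if y = z then 1 else 0 := by
  simp [move, Pi.single_apply]

/-- The parities of an odometer on the sites of `B`. -/
def parity (B : Finset V) (h : V → ℕ) (x : V) : Bool := decide (x ∈ B ∧ Odd (h x))

/-- Change of the parity at `x`, if `x` is a site of `B`. -/
def flip (B : Finset V) (e : V → Bool) (x : V) : V → Bool :=
  if x ∈ B then Function.update e x (!e x) else e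

theorem parity_add_single (B : Finset V) (h : V → ℕ) (x : V) :
    parity B (h + Pi.single x 1) = flip B (parity B h) x := by
  funext y
  by_cases hx : x ∈ B
  · by_cases hy : y = x
    · subst hy
      by_cases ho : Odd (h y) <;> simp [parity, flip, hx, ho, Nat.odd_add_one]
    · simp [parity, flip, hx, hy]
  · by_cases hy : y = x
    · subst hy
      simp [parity, flip, hx]
    · simp [parity, flip, hx, hy]

/-- A sufficient condition for `x` to be `A`-unstable, which depends only on the configuration
and on the parities of the odometer on `B`. -/
def Topplable (A B : Finset V) (c : V → ℕ) (e : V → Bool) (x : V) : Prop :=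
  2 ≤ c x ∨ (x ∉ A ∧ 1 ≤ c x) ∨ (x ∈ B ∧ c x = 1 ∧ e x = true)

theorem Topplable.not_aStable {A B : Finset V} {c h : V → ℕ} {x : V}
    (hx : Topplable A B c (parity B h) x) : ¬ AStable A (c, h) x := by
  rintro (h0 | ⟨hA, h1, he⟩)
  · rcases hx with hx | ⟨-, hx⟩ | ⟨-, hx, -⟩ <;> simp only at h0 <;> omega
  · rcases hx with hx | ⟨hx, -⟩ | ⟨-, -, hx⟩
    · simp only at h1; omega
    · exact hx hA
    · simp only [parity, decide_eq_true_eq] at hx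
      exact (Nat.not_odd_iff_even.2 he) hx.2

variable [Fintype V] (G : SimpleGraph V) [DecidableRel G.Adj]

/-- The largest probability, over adaptive choices of topplable sites, of making `n` topplings. -/
def gameVal (A B : Finset V) : ℕ → (V → ℕ) → (V → Bool) → ℝ≥0∞
  | 0, _, _ => 1
  | n + 1, c, e => ⨆ (x : V) (_ : Topplable A B c e x),
      ∑ z, jumpPMF G x z * gameVal A B n (move c x z) (flip B e x)

omit [DecidableEq V] in
theorem sum_jumpPMF (x : V) : ∑ z, jumpPMF G x z = 1 := by
  rw [← tsum_fintype (L := .unconditional V), (jumpPMF G x).tsum_coe]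

-- Thanks to truncated subtraction this also covers `n = 0`, which spares a case distinction later.
variable {G} in
theorem le_gameVal {A B : Finset V} {n : ℕ} {c : V → ℕ} {e : V → Bool} {x : V}
    (hx : Topplable A B c e x) :
    ∑ z, jumpPMF G x z * gameVal G A B (n - 1) (move c x z) (flip B e x) ≤
      gameVal G A B n c e := by
  cases n with
  | zero =>
    simp only [gameVal, Nat.zero_sub, mul_one]
    exact (sum_jumpPMF G x).le
  | succ n =>
    rw [gameVal, Nat.add_sub_cancel]
    exact le_iSup₂_of_le x hx le_rfl

theorem gameVal_succ_le (A B : Finset V) (n : ℕ) (c : V → ℕ) (e : V → Bool) :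
    gameVal G A B (n + 1) c e ≤ gameVal G A B n c e := by
  induction n generalizing c e with
  | zero =>
    refine iSup₂_le fun x _ => ?_
    simp [gameVal, sum_jumpPMF]
  | succ n ih =>
    rw [gameVal, gameVal]
    gcongr with x hx z
    exact ih _ _

theorem gameVal_anti (A B : Finset V) (c : V → ℕ) (e : V → Bool) :
    Antitone fun n => gameVal G A B n c e :=
  antitone_nat_of_succ_le fun n => gameVal_succ_le G A B n c e

/-! ### The game bounds the number of half-topplings -/

section Legal

-- A legal sequence reads at each site at most as many unused instructions as its length. This makes
-- the legality events finite-dimensional, hence measurable and independent of instructions already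
-- used.
omit [Fintype V] in
theorem ALegal.congr {A : Finset V} {α : List V} {s : SSMState V} {τ τ' : V × ℕ → V}
    (hτ : ∀ y j, s.2 y ≤ j → j < s.2 y + α.length → τ (y, j) = τ' (y, j))
    (h : ALegal τ A s α) : ALegal τ' A s α := by
  induction α generalizing s with
  | nil => trivial
  | cons x α ih =>
    have hx : halfTopple τ' x s = halfTopple τ x s := by
      simp [halfTopple, hτ x (s.2 x) le_rfl (by simp)]
    refine ⟨h.1, ?_⟩
    rw [hx]
    refine ih (fun y j h1 h2 => hτ y j ?_ ?_) h.2
    · exact le_trans (by simp [halfTopple]) h1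
    · refine lt_of_lt_of_le h2 ?_
      have : (Pi.single x 1 : V → ℕ) y ≤ 1 := by
        by_cases hy : y = x <;> simp [hy]
      simp only [halfTopple, Pi.add_apply, List.length_cons]
      omega

omit [Fintype V] in
theorem ALegal.take {A : Finset V} {α : List V} {s : SSMState V} {τ : V × ℕ → V}
    (h : ALegal τ A s α) (n : ℕ) : ALegal τ A s (α.take n) := by
  induction α generalizing s n with
  | nil => simpa using h
  | cons x α ih =>
    cases n with
    | zero => trivial
    | succ n => exact ⟨h.1, ih h.2 n⟩

/-- The instruction fields for which there is an `A`-legal sequence of length `n` from `s`. -/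
def legalSet (A : Finset V) (n : ℕ) (s : SSMState V) : Set (V × ℕ → V) :=
  {τ | ∃ α : List V, α.length = n ∧ ALegal τ A s α}

omit [Fintype V] in
theorem legalSet_anti (A : Finset V) (s : SSMState V) : Antitone fun n => legalSet A n s := by
  rintro m n hmn τ ⟨α, hα, h⟩
  exact ⟨α.take m, by simp [hα, hmn], h.take m⟩

/-- The instructions on which the first `n` half-topplings from `s` depend. -/
def usedInstr (n : ℕ) (s : SSMState V) : Finset (V × ℕ) :=
  Finset.univ.biUnion fun y => (Finset.Ico (s.2 y) (s.2 y + n)).image fun j => (y, j)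

theorem mem_usedInstr {n : ℕ} {s : SSMState V} {p : V × ℕ} :
    p ∈ usedInstr n s ↔ s.2 p.1 ≤ p.2 ∧ p.2 < s.2 p.1 + n := by
  rcases p with ⟨y, j⟩
  simp [usedInstr]

theorem legalSet_eq_preimage (A : Finset V) (n : ℕ) (s : SSMState V) :
    ∃ S : Set (usedInstr n s → V), legalSet A n s = (fun τ i => τ i) ⁻¹' S := by
  refine ⟨{σ | ∃ τ ∈ legalSet A n s, (fun i : usedInstr n s => τ i) = σ}, ?_⟩
  ext τ
  constructor
  · intro h
    exact ⟨τ, h, rfl⟩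
  · rintro ⟨τ', ⟨α, hα, h⟩, hh⟩
    refine ⟨α, hα, h.congr fun y j h1 h2 => ?_⟩
    exact congrFun hh ⟨(y, j), mem_usedInstr.2 ⟨h1, hα ▸ h2⟩⟩

variable [MeasurableSpace V] [DiscreteMeasurableSpace V]

theorem measurableSet_legalSet (A : Finset V) (n : ℕ) (s : SSMState V) :
    MeasurableSet (legalSet A n s) := by
  obtain ⟨S, hS⟩ := legalSet_eq_preimage A n s
  rw [hS]
  exact (by fun_prop : Measurable fun (τ : V × ℕ → V) (i : usedInstr n s) => τ i)
    (Set.to_countable S).measurableSet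

instance (p : V × ℕ) : IsProbabilityMeasure (jumpPMF G p.1).toMeasure :=
  PMF.toMeasure.isProbabilityMeasure _

instance : IsProbabilityMeasure (instructionLaw G) := by
  unfold instructionLaw; infer_instance

theorem instructionLaw_inter (A : Finset V) (n : ℕ) (s : SSMState V) (p : V × ℕ)
    (hp : p ∉ usedInstr n s) (z : V) :
    instructionLaw G ({τ | τ p = z} ∩ legalSet A n s) =
      jumpPMF G p.1 z * instructionLaw G (legalSet A n s) := by
  obtain ⟨S, hS⟩ := legalSet_eq_preimage A n s
  have hind : iIndepFun (fun (q : V × ℕ) (τ : V × ℕ → V) => τ q) (instructionLaw G) :=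
    iIndepFun_infinitePi (X := fun _ v => v) fun _ => measurable_id
  have h2 := hind.indepFun_finset {p} (usedInstr n s) (by simpa using hp)
    fun q => measurable_pi_apply q
  have h3 := h2.measure_inter_preimage_eq_mul
    {σ : ({p} : Finset (V × ℕ)) → V | σ ⟨p, by simp⟩ = z} S
    (Set.to_countable _).measurableSet (Set.to_countable _).measurableSet
  have h4 : instructionLaw G {τ | τ p = z} = jumpPMF G p.1 z := by
    have := (measurePreserving_eval_infinitePi
      (fun p : V × ℕ => (jumpPMF G p.1).toMeasure) p).measure_preimage
        (MeasurableSet.singleton z).nullMeasurableSet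
    rw [PMF.toMeasure_apply_singleton _ _ (MeasurableSet.singleton z)] at this
    exact this
  rw [hS, ← h4]
  exact h3

/-- For a fixed first site, the events indexed by the target of its instruction are disjoint, and
that instruction is independent of the later ones. Choosing the site inside the recursion avoids any
measurable selection of a strategy. -/
theorem gameVal_le_measure_legalSet (A B : Finset V) (n : ℕ) (c h : V → ℕ) :
    gameVal G A B n c (parity B h) ≤ instructionLaw G (legalSet A n (c, h)) := by
  induction n generalizing c h with
  | zero =>
    have : legalSet A 0 (c, h) = Set.univ :=
      Set.eq_univ_of_forall fun τ => ⟨[], rfl, trivial⟩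
    simp [gameVal, this]
  | succ n ih =>
    rw [gameVal]
    refine iSup₂_le fun x hx => ?_
    set s' : V → SSMState V := fun z => (move c x z, h + Pi.single x 1) with hs'
    have hsub : (⋃ z ∈ (Finset.univ : Finset V), {τ | τ (x, h x) = z} ∩ legalSet A n (s' z)) ⊆
        legalSet A (n + 1) (c, h) := by
      intro τ hτ
      simp only [Finset.mem_univ, Set.iUnion_true, Set.mem_iUnion] at hτ
      obtain ⟨z, hz, α, hα, hl⟩ := hτ
      refine ⟨x :: α, by simp [hα], hx.not_aStable, ?_⟩
      have : halfTopple τ x (c, h) = s' z := by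
        have hz' : τ (x, h x) = z := hz
        simp [halfTopple, s', move, hz']
      rw [this]; exact hl
    refine le_trans ?_ (measure_mono hsub)
    rw [measure_biUnion_finset]
    · refine Finset.sum_le_sum fun z _ => ?_
      rw [instructionLaw_inter G A n (s' z) (x, h x)]
      · gcongr
        rw [← parity_add_single]
        exact ih _ _
      · simp [mem_usedInstr, s']
    · intro z _ z' _ hzz
      refine Set.disjoint_left.2 fun τ h1 h2 => hzz ?_
      exact h1.1.symm.trans h2.1
    · intro z _
      exact ((measurable_pi_apply (x, h x)) (MeasurableSet.singleton z)).inter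
        (measurableSet_legalSet A n _)

omit [MeasurableSpace V] [DiscreteMeasurableSpace V] in
theorem le_numHalfTopplings {A : Finset V} {n : ℕ} {η : V → ℕ} {τ : V × ℕ → V}
    (h : τ ∈ legalSet A n (η, 0)) : (n : ℕ∞) ≤ numHalfTopplings A η τ := by
  obtain ⟨α, hα, hl⟩ := h
  have : (n : ℕ∞) = ∑ x, (α.count x : ℕ∞) := by
    rw [← hα, ← Nat.cast_sum]
    congr 1
    simpa using (Multiset.sum_count_eq_card (s := Finset.univ) (m := (α : Multiset V))
      (by simp)).symm
  rw [this]
  exact Finset.sum_le_sum fun x _ => le_iSup₂_of_le α hl le_rfl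

/-- Stochastic domination follows from a comparison with the game at all finite levels. -/
theorem stochDominates_of_le_gameVal (A B : Finset V) (η : V → ℕ)
    {Ω : Type*} [MeasurableSpace Ω] (Q : Measure Ω) (T : Ω → ℕ∞)
    (hQ : ∀ n : ℕ, Q {ω | (n : ℕ∞) ≤ T ω} ≤ gameVal G A B n η fun _ => false) :
    StochDominates (instructionLaw G) (numHalfTopplings A η) Q T := by
  have hpar : parity B (0 : V → ℕ) = fun _ => false := by
    funext x; simp [parity]
  have key : ∀ n : ℕ, Q {ω | (n : ℕ∞) ≤ T ω} ≤ instructionLaw G (legalSet A n (η, 0)) :=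
    fun n => (hQ n).trans (hpar ▸ gameVal_le_measure_legalSet G A B n η 0)
  intro k
  induction k using ENat.recTopCoe with
  | coe n => exact (key n).trans (measure_mono fun τ hτ => le_numHalfTopplings hτ)
  | top =>
    -- The value `⊤` is reached through continuity from above: legal sequences can be truncated, so
    -- the sets `legalSet A n` decrease.
    have h1 : (⋂ n, legalSet A n (η, 0)) ⊆ {τ | ⊤ ≤ numHalfTopplings A η τ} := by
      intro τ hτ
      simp only [Set.mem_ofPred_eq, top_le_iff]
      refine ENat.eq_top_iff_forall_ge.2 fun n => ?_
      exact le_numHalfTopplings (Set.mem_iInter.1 hτ n)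
    refine le_trans ?_ (measure_mono h1)
    rw [(legalSet_anti A (η, 0)).measure_iInter
      (fun n => (measurableSet_legalSet A n _).nullMeasurableSet) ⟨0, by simp⟩]
    refine le_iInf fun n => le_trans (measure_mono fun ω hω => ?_) (key n)
    simp only [Set.mem_ofPred_eq, top_le_iff] at hω ⊢
    simp [hω]

end Legal

end Sandpile

namespace Sandpile

variable {V : Type*} [DecidableEq V] [Fintype V]

/-! ### Independent random parities -/

/-- The expectation of `g e` when the parities `e y` are independent, with laws `a y`. -/
def avg (a : V → Bool → ℝ≥0∞) (g : (V → Bool) → ℝ≥0∞) : ℝ≥0∞ :=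
  ∑ e : V → Bool, (∏ y, a y (e y)) * g e

/-- The Dirac mass at a parity. -/
abbrev pt (b : Bool) : Bool → ℝ≥0∞ := Pi.single b 1

/-- Only parities of positive weight matter; this is how a parity that is almost surely odd makes a
site topplable. -/
theorem avg_mono {a : V → Bool → ℝ≥0∞} {g g' : (V → Bool) → ℝ≥0∞}
    (h : ∀ e, (∀ y, a y (e y) ≠ 0) → g e ≤ g' e) : avg a g ≤ avg a g' := by
  refine Finset.sum_le_sum fun e _ => ?_
  by_cases h0 : ∃ y, a y (e y) = 0
  · obtain ⟨y, hy⟩ := h0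
    rw [Finset.prod_eq_zero (Finset.mem_univ y) hy, zero_mul, zero_mul]
  · push Not at h0
    exact mul_le_mul_right (h e h0) _

theorem avg_sum_mul {ι : Type*} (s : Finset ι) (a : V → Bool → ℝ≥0∞) (k : ι → ℝ≥0∞)
    (g : ι → (V → Bool) → ℝ≥0∞) :
    avg a (fun e => ∑ i ∈ s, k i * g i e) = ∑ i ∈ s, k i * avg a (g i) := by
  simp only [avg, Finset.mul_sum]
  rw [Finset.sum_comm]
  refine Finset.sum_congr rfl fun i _ => Finset.sum_congr rfl fun e _ => ?_
  ring

theorem avg_const {a : V → Bool → ℝ≥0∞} (ha : ∀ y, a y false + a y true = 1) (r : ℝ≥0∞) :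
    avg a (fun _ => r) = r := by
  have h := Finset.prod_univ_sum (fun _ : V => (Finset.univ : Finset Bool)) fun y b => a y b
  simp only [Fintype.univ_bool, Finset.mem_singleton, Bool.true_eq_false, not_false_eq_true,
    Finset.sum_insert, Finset.sum_singleton] at h
  rw [avg, ← Finset.sum_mul]
  have h2 : ∑ e : V → Bool, ∏ y, a y (e y) = 1 := by
    rw [show (Finset.univ : Finset (V → Bool)) =
      Fintype.piFinset (fun _ : V => ({true, false} : Finset Bool)) by ext; simp, ← h]
    exact Finset.prod_eq_one fun y _ => by rw [add_comm, ha]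
  rw [h2, one_mul]

theorem avg_eq_sum (a : V → Bool → ℝ≥0∞) (g : (V → Bool) → ℝ≥0∞) (y : V) :
    avg a g = ∑ b, a y b * avg (Function.update a y (pt b)) g := by
  have h : ∀ (a : V → Bool → ℝ≥0∞) (e : V → Bool), ∏ z, a z (e z) =
      a y (e y) * ∏ z ∈ Finset.univ.erase y, a z (e z) := fun a e =>
    (Finset.mul_prod_erase _ _ (Finset.mem_univ y)).symm
  have h' : ∀ (b : Bool) (e : V → Bool), ∏ z, Function.update a y (pt b) z (e z) =
      pt b (e y) * ∏ z ∈ Finset.univ.erase y, a z (e z) := by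
    intro b e
    rw [h, Function.update_self]
    congr 1
    refine Finset.prod_congr rfl fun z hz => ?_
    rw [Function.update_of_ne (Finset.ne_of_mem_erase hz)]
  simp only [avg, h', Finset.mul_sum]
  rw [Finset.sum_comm]
  refine Finset.sum_congr rfl fun e _ => ?_
  rw [h a e, Finset.sum_eq_single (e y)]
  · simp [mul_assoc]
  · intro b _ hb
    simp [pt, hb.symm]
  · simp

theorem avg_update (a : V → Bool → ℝ≥0∞) (g : (V → Bool) → ℝ≥0∞) (y : V) (q : Bool → ℝ≥0∞) :
    avg (Function.update a y q) g = ∑ b, q b * avg (Function.update a y (pt b)) g := by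
  rw [avg_eq_sum _ g y]
  simp

/-- Flipping at `y` is an involution of the parity fields, so it can be moved from the integrand to
the law. -/
theorem avg_flip {B : Finset V} {y : V} (hy : y ∈ B) (a : V → Bool → ℝ≥0∞)
    (g : (V → Bool) → ℝ≥0∞) (b : Bool) :
    avg (Function.update a y (pt b)) (fun e => g (flip B e y)) =
      avg (Function.update a y (pt !b)) g := by
  have hinv : Function.Involutive fun e : V → Bool => flip B e y := by
    intro e
    simp [flip, hy]
  refine Fintype.sum_equiv hinv.toPerm _ _ fun e => ?_
  simp only [Function.Involutive.coe_toPerm]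
  congr 1
  refine Finset.prod_congr rfl fun z _ => ?_
  by_cases hz : z = y
  · subst hz
    simp only [flip, hy, if_true, Function.update_self]
    cases b <;> cases e z <;> simp [pt]
  · simp [flip, hy, hz]

/-- Each parity is distributed according to a probability, and, on `S`, it is odd with probability
at least `1 / (1 + lam)`. -/
structure IsParityLaw (lam : ℝ≥0∞) (S : Finset V) (a : V → Bool → ℝ≥0∞) : Prop where
  total : ∀ y, a y false + a y true = 1
  odd : ∀ y ∈ S, a y false ≤ lam * a y true

omit [Fintype V] in
theorem IsParityLaw.update {lam : ℝ≥0∞} {S : Finset V} {a : V → Bool → ℝ≥0∞}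
    (h : IsParityLaw lam S a) {S' : Finset V} {y : V} (hS : S' ⊆ insert y S) {q : Bool → ℝ≥0∞}
    (hq : q false + q true = 1) (hq' : y ∈ S' → q false ≤ lam * q true) :
    IsParityLaw lam S' (Function.update a y q) := by
  constructor
  · intro z
    by_cases hz : z = y
    · subst hz; simpa using hq
    · simpa [hz] using h.total z
  · intro z hz
    by_cases hzy : z = y
    · subst hzy; simpa using hq' hz
    · simpa [hzy] using h.odd z ((Finset.mem_insert.1 (hS hz)).resolve_left hzy)

omit [DecidableEq V] [Fintype V] in
theorem IsParityLaw.mono {lam : ℝ≥0∞} {S S' : Finset V} {a : V → Bool → ℝ≥0∞}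
    (h : IsParityLaw lam S a) (hS : S' ⊆ S) : IsParityLaw lam S' a :=
  ⟨h.total, fun y hy => h.odd y (hS hy)⟩

theorem pt_total (b : Bool) : pt b false + pt b true = 1 := by
  cases b <;> simp [pt]

/-! ### Randomisation of a parity by loops of length two -/

variable (G : SimpleGraph V) [DecidableRel G.Adj]

open Classical in
/-- The law of the site reached by a particle which jumps from `y`, and jumps once more if it falls
on a site where it can certainly be toppled. -/
def loopKernel (A : Finset V) (c : V → ℕ) (y u : V) : ℝ≥0∞ :=
  ∑ z, jumpPMF G y z *
    if z ∉ A ∨ 1 ≤ c z then jumpPMF G z u else if u = z then 1 else 0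

omit [DecidableEq V] in
theorem adj_of_jumpPMF_ne_zero {y z : V} (hy : 0 < G.degree y) (h : jumpPMF G y z ≠ 0) :
    G.Adj y z := by
  have hne : (G.neighborFinset y).Nonempty := Finset.card_pos.1 hy
  rw [jumpPMF, dif_pos hne, ← PMF.mem_support_iff, PMF.mem_support_uniformOfFinset_iff] at h
  simpa using h

omit [DecidableEq V] in
theorem inv_maxDegree_le_jumpPMF {y z : V} (h : G.Adj y z) :
    (G.maxDegree : ℝ≥0∞)⁻¹ ≤ jumpPMF G y z := by
  have hz : z ∈ G.neighborFinset y := by simpa using h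
  have hne : (G.neighborFinset y).Nonempty := ⟨z, hz⟩
  rw [jumpPMF, dif_pos hne, PMF.uniformOfFinset_apply_of_mem _ hz]
  exact ENNReal.inv_le_inv.2 (by exact_mod_cast G.degree_le_maxDegree y)

theorem loopKernel_le_one (A : Finset V) (c : V → ℕ) (y u : V) : loopKernel G A c y u ≤ 1 := by
  rw [← sum_jumpPMF G y]
  refine Finset.sum_le_sum fun z _ => mul_le_of_le_one_right' ?_
  split_ifs
  · exact PMF.coe_le_one _ _
  · exact le_rfl
  · exact zero_le_one

/-- The loop `y → z → y` has probability at least `Δ⁻²`; one factor `Δ` of `Δ ^ 3` is to spare. -/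
theorem one_le_mul_loopKernel {A : Finset V} {c : V → ℕ} {y z : V} (h : G.Adj y z)
    (hz : z ∉ A ∨ 1 ≤ c z) : 1 ≤ (G.maxDegree : ℝ≥0∞) ^ 3 * loopKernel G A c y y := by
  have hpos : 0 < G.maxDegree :=
    lt_of_lt_of_le ((G.degree_pos_iff_exists_adj y).2 ⟨z, h⟩) (G.degree_le_maxDegree y)
  have h1 : (G.maxDegree : ℝ≥0∞)⁻¹ * (G.maxDegree : ℝ≥0∞)⁻¹ ≤ loopKernel G A c y y := by
    refine le_trans (mul_le_mul' (inv_maxDegree_le_jumpPMF G h)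
      (inv_maxDegree_le_jumpPMF G h.symm)) ?_
    refine le_trans ?_ (Finset.single_le_sum (fun _ _ => zero_le) (Finset.mem_univ z))
    rw [if_pos hz]
  have h0 : (G.maxDegree : ℝ≥0∞) ≠ 0 := by exact_mod_cast hpos.ne'
  have ht : (G.maxDegree : ℝ≥0∞) ≠ ⊤ := ENNReal.natCast_ne_top _
  calc (1 : ℝ≥0∞) ≤ G.maxDegree := by exact_mod_cast hpos
    _ = (G.maxDegree : ℝ≥0∞) * (G.maxDegree * (G.maxDegree : ℝ≥0∞)⁻¹) *
        (G.maxDegree * (G.maxDegree : ℝ≥0∞)⁻¹) := by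
      rw [ENNReal.mul_inv_cancel h0 ht, mul_one, mul_one]
    _ = (G.maxDegree : ℝ≥0∞) ^ 3 * ((G.maxDegree : ℝ≥0∞)⁻¹ * (G.maxDegree : ℝ≥0∞)⁻¹) := by ring
    _ ≤ _ := by gcongr

omit [Fintype V] in
theorem move_move (c : V → ℕ) {y z : V} (u : V) : move (move c y z) z u = move c y u := by
  funext v
  simp only [move_apply]
  by_cases h : v = z <;> simp [h]

omit [Fintype V] in
theorem move_self {c : V → ℕ} {y : V} (h : 1 ≤ c y) : move c y y = c := by
  funext v
  simp only [move_apply]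
  by_cases hv : v = y
  · subst hv; simp; omega
  · simp [hv]

/-- The intermediate site lies outside `B`, so only the parity at `y` changes. A second toppling, if
made, is not counted, which is harmless since `gameVal` decreases in `n`. -/
theorem sum_loopKernel_mul_le_gameVal {A B : Finset V} {c : V → ℕ} {e : V → Bool} {y : V}
    (hy : 0 < G.degree y) (hdisc : ∀ z, G.Adj y z → z ∉ B) (hc : 2 ≤ c y) (n : ℕ) :
    ∑ u, loopKernel G A c y u * gameVal G A B (n - 1) (move c y u) (flip B e y) ≤
      gameVal G A B n c e := by
  refine le_trans ?_ (le_gameVal (x := y) (Or.inl hc))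
  simp only [loopKernel, Finset.sum_mul]
  rw [Finset.sum_comm]
  refine Finset.sum_le_sum fun z _ => ?_
  simp only [mul_assoc, ← Finset.mul_sum]
  by_cases hz0 : jumpPMF G y z = 0
  · simp [hz0]
  have hadj := adj_of_jumpPMF_ne_zero G hy hz0
  refine mul_le_mul_right ?_ _
  by_cases hz : z ∉ A ∨ 1 ≤ c z
  · simp only [if_pos hz]
    have hne : z ≠ y := hadj.ne'
    have hmz : move c y z z = c z + 1 := by simp [move_apply, hne]
    have ht : Topplable A B (move c y z) (flip B e y) z := by
      rcases hz with hz | hz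
      · exact Or.inr (Or.inl ⟨hz, by omega⟩)
      · exact Or.inl (by omega)
    refine le_trans (Finset.sum_le_sum fun u _ => ?_) (le_gameVal ht)
    rw [move_move, flip, flip, if_neg (hdisc z hadj)]
    exact mul_le_mul_right (gameVal_anti G A B _ _ (Nat.sub_le _ _)) _
  · simp only [if_neg hz, ite_mul, one_mul, zero_mul, Finset.sum_ite_eq', Finset.mem_univ, if_true]
    exact le_rfl

/-- The parity of a site `y` which is toppled can be randomised by means of loops of length two:
a bound on the value of the game follows from bounds for the configurations obtained when the
particle finally leaves `y`, with a random parity at `y`. -/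
theorem le_avg_gameVal_of_loop {lam : ℝ≥0∞} (hlam : 1 ≤ lam) {A B : Finset V} {c : V → ℕ} {y : V}
    (hyB : y ∈ B) (hy : 0 < G.degree y) (hdisc : ∀ z, G.Adj y z → z ∉ B) (hc : 2 ≤ c y)
    (hr : 1 ≤ lam * loopKernel G A c y y) {a : V → Bool → ℝ≥0∞} (ha : a y false + a y true = 1)
    {n : ℕ} {W : V → ℝ≥0∞} (hW1 : W y ≠ ⊤) (hWK : W y ≤ ∑ u, loopKernel G A c y u * W u)
    (hself : ∀ b, W y ≤ avg (Function.update a y (pt b)) (gameVal G A B (n - 1) c))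
    (hexit : ∀ u ≠ y, ∀ q : Bool → ℝ≥0∞, q false + q true = 1 → q false ≤ lam * q true →
      W u ≤ avg (Function.update a y q) (gameVal G A B (n - 1) (move c y u))) :
    W y ≤ avg a (gameVal G A B n c) := by
  set K := loopKernel G A c y with hK
  set r := K y with hr'
  have hrle : r ≤ 1 := loopKernel_le_one G A c y y
  have hrt : r ≠ ⊤ := ne_top_of_le_ne_top ENNReal.one_ne_top hrle
  have hr1t : 1 + r ≠ ⊤ := ENNReal.add_ne_top.2 ⟨ENNReal.one_ne_top, hrt⟩
  have hr10 : 1 + r ≠ 0 := by simp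
  -- The value when the particle has reached `u`, with `m` topplings to go and parity `b` at `y`;
  -- for `u = y` the configuration is `c` itself.
  set X : V → ℕ → Bool → ℝ≥0∞ := fun u m b =>
    avg (Function.update a y (pt b)) (gameVal G A B m (move c y u)) with hX
  have hXanti : ∀ u b {m m' : ℕ}, m ≤ m' → X u m' b ≤ X u m b := fun u b m m' h =>
    avg_mono fun e _ => gameVal_anti G A B _ _ h
  have hstep : ∀ (m : ℕ) (b : Bool), ∑ u, K u * X u (m - 1) (!b) ≤ X y m b := by
    intro m b
    simp only [hX]
    rw [move_self (by omega)]
    simp_rw [← avg_flip hyB]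
    rw [← avg_sum_mul]
    exact avg_mono fun e _ => sum_loopKernel_mul_le_gameVal G hy hdisc hc m
  have hstep' : ∀ (m : ℕ) (b : Bool), ∑ u, K u * X u m (!b) ≤ X y m b := fun m b => by
    refine le_trans ?_ (hstep m b)
    gcongr with u
    exact hXanti u _ (Nat.sub_le _ _)
  have hsplit : ∀ F : V → ℝ≥0∞, ∑ u, K u * F u = r * F y + ∑ u ∈ Finset.univ.erase y, K u * F u :=
    fun F => (Finset.add_sum_erase _ _ (Finset.mem_univ y)).symm
  have hself' : ∀ b, W y ≤ X y (n - 1) b := by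
    intro b
    simp only [hX]
    rw [move_self (by omega)]
    exact hself b
  -- Leaving at the first loop yields parity `!b` with weight `1`, at the second one parity `b` with
  -- weight `r`; `q` is the normalised law. It is admissible by `1 ≤ lam * r` if odd has weight `r`,
  -- and by `r ≤ 1 ≤ lam` otherwise.
  have hmix : ∀ u ≠ y, ∀ b, (1 + r) * W u ≤ X u (n - 1) (!b) + r * X u (n - 1) b := by
    intro u hu b
    set q : Bool → ℝ≥0∞ := fun b' => if b' = b then r / (1 + r) else 1 / (1 + r) with hq
    have hq1 : q false + q true = 1 := by
      have : r / (1 + r) + 1 / (1 + r) = 1 := by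
        rw [← ENNReal.add_div, add_comm r 1, ENNReal.div_self hr10 hr1t]
      cases b
      · simpa [hq] using this
      · rw [add_comm]; simpa [hq] using this
    have hrd : 1 / (1 + r) ≤ lam * (r / (1 + r)) := by
      rw [← mul_div_assoc]; exact ENNReal.div_le_div_right hr _
    have hr1 : r / (1 + r) ≤ lam * (1 / (1 + r)) := by
      rw [← mul_div_assoc, mul_one]
      exact ENNReal.div_le_div_right (hrle.trans hlam) _
    have hq2 : q false ≤ lam * q true := by
      cases b
      · simpa [hq] using hr1
      · simpa [hq] using hrd
    have h := hexit u hu q hq1 hq2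
    rw [avg_update] at h
    calc (1 + r) * W u ≤ (1 + r) * (q (!b) * X u (n - 1) (!b) + q b * X u (n - 1) b) := by
          gcongr
          refine h.trans (le_of_eq ?_)
          cases b
          · simp [hX]
          · simp [hX, add_comm]
      _ = (1 + r) * (1 / (1 + r)) * X u (n - 1) (!b) +
          (1 + r) * (r / (1 + r)) * X u (n - 1) b := by
          simp only [hq]
          simp
          ring
      _ = _ := by
          rw [ENNReal.mul_div_cancel hr10 hr1t, ENNReal.mul_div_cancel hr10 hr1t, one_mul]
  have hmain : ∀ b, W y ≤ X y n b := by
    intro b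
    set Ex := ∑ u ∈ Finset.univ.erase y, K u * W u with hEx
    -- Two rounds are unrolled; after two returns, of weight `r * r`, the bound `hself'` is used.
    have h1 : r * (r * W y) + (1 + r) * Ex ≤ X y n b := by
      have e1 := hstep n b
      have e2 := (hstep' (n - 1) (!b))
      rw [hsplit] at e1 e2
      simp only [Bool.not_not] at e2
      refine le_trans ?_ e1
      calc r * (r * W y) + (1 + r) * Ex
          ≤ r * (r * X y (n - 1) b) + ∑ u ∈ Finset.univ.erase y,
            (K u * X u (n - 1) (!b) + r * (K u * X u (n - 1) b)) := by
            gcongr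
            · exact hself' b
            · rw [hEx, Finset.mul_sum]
              refine Finset.sum_le_sum fun u hu => ?_
              have h2 := hmix u (Finset.ne_of_mem_erase hu) b
              calc (1 + r) * (K u * W u) = K u * ((1 + r) * W u) := by ring
                _ ≤ K u * (X u (n - 1) (!b) + r * X u (n - 1) b) := by gcongr
                _ = _ := by ring
        _ = r * (r * X y (n - 1) b + ∑ u ∈ Finset.univ.erase y, K u * X u (n - 1) b) +
            ∑ u ∈ Finset.univ.erase y, K u * X u (n - 1) (!b) := by
            rw [Finset.sum_add_distrib, ← Finset.mul_sum]; ring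
        _ ≤ _ := by gcongr
    rw [hsplit] at hWK
    refine le_trans ?_ h1
    -- This is `W y ≤ r * W y + Ex` multiplied by `1 + r`; the finite term `r * W y` is then
    -- cancelled.
    have h3 : r * W y + W y ≤ r * W y + (r * (r * W y) + (1 + r) * Ex) := by
      calc r * W y + W y = (1 + r) * W y := by ring
        _ ≤ (1 + r) * (r * W y + Ex) := by gcongr
        _ = _ := by ring
    exact (ENNReal.add_le_add_iff_left (ENNReal.mul_ne_top hrt hW1)).1 h3
  have hXy : ∀ b, X y n b = avg (Function.update a y (pt b)) (gameVal G A B n c) := by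
    intro b
    simp only [hX]
    rw [move_self (by omega)]
  rw [avg_eq_sum a _ y]
  calc W y = (a y false + a y true) * W y := by rw [ha, one_mul]
    _ = ∑ b, a y b * W y := by simp; ring
    _ ≤ _ := by
      refine Finset.sum_le_sum fun b _ => ?_
      rw [← hXy]
      gcongr
      exact hmain b

end Sandpile

namespace Sandpile

variable {V : Type*} [DecidableEq V] [Fintype V] (G : SimpleGraph V) [DecidableRel G.Adj]

/-! ### The game during an excursion of one particle -/

/-- One particle on each site of `A`. -/
def fullConfig (A : Finset V) (v : V) : ℕ := if v ∈ A then 1 else 0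

theorem avg_sum_le_of_topplable {A B : Finset V} {c : V → ℕ} {x : V} {a : V → Bool → ℝ≥0∞}
    (hx : ∀ e, (∀ y, a y (e y) ≠ 0) → Topplable A B c e x) (n : ℕ) :
    ∑ z, jumpPMF G x z * avg a (fun e => gameVal G A B (n - 1) (move c x z) (flip B e x)) ≤
      avg a (gameVal G A B n c) := by
  rw [← avg_sum_mul]
  exact avg_mono fun e he => le_gameVal (hx e he)

/-- The sites visited by a walk which arrives at `z`, when only the sites of `B` other than `x`
are recorded. -/
def record (B : Finset V) (x : V) (S : Finset V) (z : V) : Finset V :=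
  if z ∈ B ∧ z ≠ x then insert z S else S

variable {G}

/-- `U w S` stands for the expected final value when the walk is at `w` and `S` is the active set so
far. The set `S.erase w` appears because the site `w` just reached is neither paid for nor
randomised until the particle leaves it. Induction on `n` makes the length of the excursion
irrelevant. -/
theorem excursion_le_avg_gameVal {A B : Finset V} (hBA : B ⊆ A) (hBdeg : ∀ x ∈ B, 2 ≤ G.degree x)
    (hBdisc : ∀ x ∈ B, ∀ y ∈ B, ¬ G.Adj x y) {lam : ℝ≥0∞} (hlam : lam = (G.maxDegree : ℝ≥0∞) ^ 3)
    (hΔ : 1 ≤ G.maxDegree) {x : V} (hx : x ∈ B) {k : ℕ} {U : V → Finset V → ℝ≥0∞}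
    (hU1 : ∀ w S, U w S ≤ 1)
    (hUP : ∀ w S, w ≠ x → U w S ≤ ∑ z, jumpPMF G w z * U z (record B x S z))
    (hUx : ∀ S ⊆ B.erase x, ∀ n ≤ k - S.card, ∀ a, IsParityLaw lam S a →
      U x S ≤ avg a (gameVal G A B n (fullConfig A)))
    (n : ℕ) (w : V) (S : Finset V) (hS : S ⊆ B.erase x) (hw : w ∈ B → w ≠ x → w ∈ S)
    (hn : n ≤ k - (S.erase w).card) (a : V → Bool → ℝ≥0∞) (ha : IsParityLaw lam (S.erase w) a) :
    U w S ≤ avg a (gameVal G A B n (move (fullConfig A) x w)) := by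
  have hlam1 : 1 ≤ lam := by
    rw [hlam]; exact one_le_pow₀ (by exact_mod_cast hΔ)
  have hxA : x ∈ A := hBA hx
  have hx1 : 1 ≤ fullConfig A x := by simp [fullConfig, hxA]
  have hrec : ∀ S ⊆ B.erase x, ∀ z, record B x S z ⊆ B.erase x := by
    intro S hS z
    unfold record
    split_ifs with h
    · exact Finset.insert_subset (Finset.mem_erase.2 ⟨h.2, h.1⟩) hS
    · exact hS
  have hrecm : ∀ S z, z ∈ B → z ≠ x → z ∈ record B x S z := by
    intro S z h1 h2
    simp [record, h1, h2]
  have hrece : ∀ S z, (record B x S z).erase z ⊆ S.erase z := by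
    intro S z
    unfold record
    split_ifs with h
    · rw [Finset.erase_insert_eq_erase]
    · exact subset_rfl
  induction n using Nat.strong_induction_on generalizing w S a with
  | _ n ih =>
  rcases Nat.eq_zero_or_pos n with rfl | hn0
  · have : gameVal G A B 0 (move (fullConfig A) x w) = fun _ => 1 := rfl
    rw [this, avg_const ha.total]
    exact hU1 _ _
  by_cases hwx : w = x
  · subst hwx
    have hwS : w ∉ S := fun h => (Finset.mem_erase.1 (hS h)).1 rfl
    rw [Finset.erase_eq_of_notMem hwS] at hn ha
    rw [move_self hx1]
    exact hUx S hS n hn a ha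
  have hcw : move (fullConfig A) x w w = fullConfig A w + 1 := by
    simp [move_apply, hwx]
  by_cases hwB : w ∈ B
  · have hwS := hw hwB hwx
    have hdeg : 0 < G.degree w := lt_of_lt_of_le two_pos (hBdeg w hwB)
    have hdisc : ∀ z, G.Adj w z → z ∉ B := fun z hz hzB => hBdisc w hwB z hzB hz
    -- Neighbours of `w` lie outside `B`, so they differ from `x`, the only site of `A` that may be
    -- empty.
    have hgood : ∀ z, G.Adj w z → z ∉ A ∨ 1 ≤ move (fullConfig A) x w z := by
      intro z hz
      by_cases hzA : z ∈ A
      · right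
        have hzx : z ≠ x := by rintro rfl; exact hdisc _ hz hx
        simp [move_apply, hzx, fullConfig, hzA]
      · exact Or.inl hzA
    have hrw : record B x S w = S := by
      simp [record, hwS]
    obtain ⟨z₀, hz₀⟩ := (G.degree_pos_iff_exists_adj w).1 hdeg
    have key := le_avg_gameVal_of_loop G (A := A) (c := move (fullConfig A) x w) (n := n)
      (W := fun u => U u (record B x S u)) hlam1 hwB hdeg hdisc
      (by rw [hcw]; simp [fullConfig, hBA hwB])
      (hlam ▸ one_le_mul_loopKernel G hz₀ (hgood z₀ hz₀)) (ha.total w)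
      (ne_top_of_le_ne_top ENNReal.one_ne_top (hU1 _ _)) ?_ ?_ ?_
    · simpa only [hrw] using key
    -- The intermediate site is always toppled and never recorded, so the loop kernel is the
    -- two-step transition of the walk.
    · simp only [hrw]
      refine (hUP w S hwx).trans ?_
      simp only [loopKernel, Finset.sum_mul]
      rw [Finset.sum_comm]
      refine Finset.sum_le_sum fun z _ => ?_
      by_cases hz0 : jumpPMF G w z = 0
      · simp [hz0]
      have hadj := adj_of_jumpPMF_ne_zero G hdeg hz0
      have hzB := hdisc z hadj
      have hzx : z ≠ x := by rintro rfl; exact hzB hx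
      simp only [if_pos (hgood z hadj), mul_assoc, ← Finset.mul_sum]
      refine mul_le_mul_right ?_ _
      have : record B x S z = S := by simp [record, hzB]
      rw [this]
      exact hUP z S hzx
    · intro b
      simp only [hrw]
      refine ih (n - 1) (by omega) w S hS hw (by omega) _ ?_
      exact ha.update (Finset.subset_insert _ _) (pt_total b) (by simp)
    · intro u hu q hq1 hq2
      rw [move_move]
      have h1 : (record B x S u).erase u ⊆ S := (hrece S u).trans (Finset.erase_subset _ _)
      have h2 := Finset.card_le_card h1
      have h3 := Finset.card_erase_add_one hwS
      refine ih (n - 1) (by omega) u _ (hrec S hS u) (hrecm S u) (by omega) _ ?_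
      exact ha.update (by rw [Finset.insert_erase hwS]; exact h1) hq1 fun _ => hq2
  · have hwS : w ∉ S := fun h => hwB (Finset.mem_erase.1 (hS h)).2
    rw [Finset.erase_eq_of_notMem hwS] at hn ha
    refine (hUP w S hwx).trans (le_trans ?_ (avg_sum_le_of_topplable G (x := w) ?_ n))
    · refine Finset.sum_le_sum fun z _ => mul_le_mul_right ?_ _
      simp only [move_move, flip, if_neg hwB]
      have h1 : (record B x S z).erase z ⊆ S := (hrece S z).trans (Finset.erase_subset _ _)
      have h2 := Finset.card_le_card h1
      exact ih (n - 1) (by omega) z _ (hrec S hS z) (hrecm S z) (by omega) _ (ha.mono h1)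
    · intro e _
      by_cases hwA : w ∈ A
      · left; rw [hcw]; simp [fullConfig, hwA]
      · right; left; exact ⟨hwA, by omega⟩

end Sandpile

namespace Sandpile

open SiteState

variable {V : Type*} [DecidableEq V]

/-! ### Deactivation on `B` with one particle per site -/

/-- The configuration with one particle on each site of `B`, active on `S` and asleep elsewhere. -/
def stateConfig (B S : Finset V) : Config V :=
  fun z => if z ∈ S then act 1 else if z ∈ B then slp else act 0

theorem update_stateConfig {B S : Finset V} {x : V} (hx : x ∈ B) :
    Function.update (stateConfig B S) x slp = stateConfig B (S.erase x) := by
  funext z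
  by_cases hz : z = x
  · subst hz; simp [stateConfig, hx]
  · simp [stateConfig, hz]

/-- Hence the ARWD walk from `x` stops exactly at its first return to `x`. -/
theorem emptySites_stateConfig {B S : Finset V} {x : V} (hx : x ∈ S) (hS : S ⊆ B) :
    emptySites B (stateConfig B S) x = {x} := by
  ext z
  simp only [emptySites, Set.mem_ofPred_eq, Set.mem_singleton_iff]
  by_cases hz : z = x
  · subst hz; simp [stateConfig, hx, hS hx, SiteState.pred]
  · simp only [hz, iff_false, not_and, Function.update_of_ne (Ne.symm (Ne.symm hz))]
    intro hzB
    by_cases hzS : z ∈ S <;> simp [stateConfig, hzS, hzB]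

/-- `X` follows up to time `s ≥ 1` a walk from `x` which does not return to `x` before time `s`, and
is at `w` at time `s`; the set `S` is `S₀` with the sites of `B` other than `x` visited by then. -/
structure IsExcursion (B S₀ : Finset V) (x : V) (s : ℕ) (X : ℕ → V) (w : V) (S : Finset V) :
    Prop where
  start : X 0 = x
  pos : 1 ≤ s
  ne : ∀ i, 1 ≤ i → i < s → X i ≠ x
  last : X s = w
  mem : ∀ v, v ∈ S ↔ v ∈ S₀ ∨ (v ∈ B ∧ v ≠ x ∧ ∃ i, 1 ≤ i ∧ i ≤ s ∧ X i = v)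

theorem IsExcursion.succ {B S₀ S : Finset V} {x w : V} {s : ℕ} {X : ℕ → V}
    (h : IsExcursion B S₀ x s X w S) (hw : w ≠ x) (z : V) :
    IsExcursion B S₀ x (s + 1) (Function.update X (s + 1) z) z (record B x S z) := by
  have hX : ∀ i ≤ s, Function.update X (s + 1) z i = X i := fun i hi =>
    Function.update_of_ne (by omega) _ _
  refine ⟨?_, by omega, ?_, by simp, ?_⟩
  · rw [hX 0 (by omega), h.start]
  · intro i h1 h2
    rw [hX i (by omega)]
    rcases Nat.lt_or_ge i s with hi | hi
    · exact h.ne i h1 hi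
    · rw [show i = s by omega, h.last]; exact hw
  · intro v
    have hr : v ∈ record B x S z ↔ v ∈ S ∨ (v = z ∧ z ∈ B ∧ z ≠ x) := by
      unfold record
      split_ifs with h'
      · simp [h', or_comm]
      · simp [h']
    rw [hr, h.mem]
    constructor
    · rintro ((h0 | ⟨h1, h2, i, h3, h4, h5⟩) | ⟨rfl, h1, h2⟩)
      · exact Or.inl h0
      · exact Or.inr ⟨h1, h2, i, h3, by omega, by rw [hX i h4, h5]⟩
      · exact Or.inr ⟨h1, h2, s + 1, by omega, le_rfl, by simp⟩
    · rintro (h0 | ⟨h1, h2, i, h3, h4, h5⟩)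
      · exact Or.inl (Or.inl h0)
      · rcases Nat.lt_or_ge s i with hi | hi
        · rw [show i = s + 1 by omega, Function.update_self] at h5
          subst h5
          exact Or.inr ⟨rfl, h1, h2⟩
        · rw [hX i hi] at h5
          exact Or.inl (Or.inr ⟨h1, h2, i, h3, hi, h5⟩)

theorem IsExcursion.first (B S₀ : Finset V) (x z : V) (hzx : z ≠ x) :
    IsExcursion B S₀ x 1 (Function.update (fun _ => x) 1 z) z (record B x S₀ z) := by
  refine ⟨by simp, le_rfl, fun i h1 h2 => by omega, by simp, fun v => ?_⟩
  have hr : v ∈ record B x S₀ z ↔ v ∈ S₀ ∨ (v = z ∧ z ∈ B ∧ z ≠ x) := by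
    unfold record
    split_ifs with h'
    · simp [h', or_comm]
    · simp [h']
  rw [hr]
  refine or_congr_right ⟨?_, ?_⟩
  · rintro ⟨rfl, h1, h2⟩
    exact ⟨h1, h2, 1, le_rfl, le_rfl, by simp⟩
  · rintro ⟨h1, h2, i, h3, h4, h5⟩
    rw [show i = 1 by omega, Function.update_self] at h5
    subst h5
    exact ⟨rfl, h1, h2⟩

theorem IsExcursion.walkResult_eq {B S₀ S : Finset V} {x : V} {s : ℕ} {X : ℕ → V}
    (h : IsExcursion B S₀ x s X x S) (hx : x ∈ B) (hS₀ : S₀ ⊆ B.erase x) :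
    walkResult B (stateConfig B (insert x S₀)) x X = stateConfig B S := by
  classical
  have hxS₀ : x ∉ S₀ := fun h => (Finset.mem_erase.1 (hS₀ h)).1 rfl
  have hemp : emptySites B (stateConfig B (insert x S₀)) x = {x} :=
    emptySites_stateConfig (Finset.mem_insert_self _ _)
      (Finset.insert_subset hx (hS₀.trans (Finset.erase_subset _ _)))
  have hex : ∃ n, 1 ≤ n ∧ X n ∈ emptySites B (stateConfig B (insert x S₀)) x :=
    ⟨s, h.pos, by rw [hemp]; exact h.last⟩
  have hfind : Nat.find hex = s := by
    rw [Nat.find_eq_iff]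
    refine ⟨⟨h.pos, by rw [hemp]; exact h.last⟩, fun n hn h' => ?_⟩
    rw [hemp] at h'
    exact h.ne n h'.1 hn h'.2
  rw [walkResult, dif_pos hex, hfind]
  funext z
  rw [afterWalk, h.last]
  by_cases hz : z = x
  · subst hz
    have : z ∉ S := fun hm => by
      rcases (h.mem z).1 hm with h0 | h0
      · exact hxS₀ h0
      · exact h0.2.1 rfl
    simp [stateConfig, this, hx]
  · simp only [Function.update_of_ne hz, Config.wake, Set.mem_ofPred_eq]
    have hm := h.mem z
    by_cases hz0 : z ∈ S₀
    · have : z ∈ S := hm.2 (Or.inl hz0)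
      simp [stateConfig, hz0, this]
    · by_cases hzB : z ∈ B
      -- The ranges `0 ≤ t < s` and `1 ≤ t ≤ s` agree here, since the walk is at `x ≠ z` at times
      -- `0` and `s`.
      · have hiff : (∃ t < s, X t = z) ↔ z ∈ S := by
          rw [hm]
          constructor
          · rintro ⟨t, ht, rfl⟩
            refine Or.inr ⟨hzB, hz, t, ?_, ht.le, rfl⟩
            rcases Nat.eq_zero_or_pos t with rfl | h0
            · exact absurd h.start hz
            · exact h0
          · rintro (h0 | ⟨-, -, i, -, h2, h3⟩)
            · exact absurd h0 hz0
            · refine ⟨i, lt_of_le_of_ne h2 ?_, h3⟩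
              rintro rfl
              exact hz (h3.symm.trans h.last)
        simp only [hiff]
        by_cases hzS : z ∈ S <;> simp [stateConfig, hz, hz0, hzB, hzS]
      · have : z ∉ S := fun hh => by
          rcases hm.1 hh with h0 | h0
          · exact hz0 h0
          · exact hzB h0.1
        simp [stateConfig, hz, hz0, hzB, this]

/-! ### Survival probabilities of ARWD and their comparison with the game -/

variable [Fintype V] [MeasurableSpace V] [DiscreteMeasurableSpace V]
variable (G : SimpleGraph V) [DecidableRel G.Adj]

omit [DecidableEq V] in
theorem lintegral_trajFrom_walkKernel (s : ℕ) (X : ℕ → V) {F : (ℕ → V) → ℝ≥0∞}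
    (hF : Measurable F) :
    ∫⁻ Y, F Y ∂trajFrom (walkKernel G) s X =
      ∑ z, jumpPMF G (X s) z * ∫⁻ Y, F Y ∂trajFrom (walkKernel G) (s + 1)
        (Function.update X (s + 1) z) := by
  rw [lintegral_trajFrom_succ _ _ _ hF]
  have : walkKernel G s (Preorder.frestrictLe s X) = (jumpPMF G (X s)).toMeasure := rfl
  rw [this, lintegral_fintype]
  refine Finset.sum_congr rfl fun z _ => ?_
  rw [PMF.toMeasure_apply_singleton _ _ (MeasurableSet.singleton z), mul_comm]

/-- The histories for which the strategy makes a toppling at each of the times `t, …, t + n - 1`. -/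
def survivalSet (f : Strategy V) (n t : ℕ) : Set (ℕ → Config V) :=
  {ω | ∀ i, t ≤ i → i < t + n → f.choose i (fun j => ω j) ≠ none}

omit [DecidableEq V] [MeasurableSpace V] [DiscreteMeasurableSpace V] in
theorem measurableSet_survivalSet (f : Strategy V) (n t : ℕ) :
    MeasurableSet (survivalSet f n t) := by
  have : survivalSet f n t = ⋂ i, ⋂ (_ : t ≤ i), ⋂ (_ : i < t + n),
      (fun (ω : ℕ → Config V) (j : Finset.Iic i) => ω j) ⁻¹' {h | f.choose i h ≠ none} := by
    ext ω; simp [survivalSet]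
  rw [this]
  refine MeasurableSet.iInter fun i => MeasurableSet.iInter fun _ => MeasurableSet.iInter fun _ => ?_
  exact (by fun_prop : Measurable fun (ω : ℕ → Config V) (j : Finset.Iic i) => ω j)
    (Set.to_countable _).measurableSet

/-- The probability that the strategy makes `n` more topplings, given the history of `ω` up to
time `t`. -/
def survival (lam : ℝ≥0) (B : Finset V) (f : Strategy V) (n t : ℕ) (ω : ℕ → Config V) : ℝ≥0∞ :=
  trajFrom (arwdKernel G lam B f) t ω (survivalSet f n t)

theorem survival_le_one (lam : ℝ≥0) (B : Finset V) (f : Strategy V) (n t : ℕ)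
    (ω : ℕ → Config V) : survival G lam B f n t ω ≤ 1 := prob_le_one

variable {G}

theorem survival_succ_of_none {lam : ℝ≥0} {B : Finset V} {f : Strategy V} {n t : ℕ}
    {ω : ℕ → Config V} (h : f.choose t (fun j => ω j) = none) :
    survival G lam B f (n + 1) t ω = 0 := by
  refine measure_mono_null ?_ (ae_trajFrom (arwdKernel G lam B f) t ω)
  intro X hX hX'
  refine hX t le_rfl (by omega) ?_
  rw [← h]
  congr 1
  funext j
  exact hX' j (Finset.mem_Iic.1 j.2)

theorem survival_succ_le (lam : ℝ≥0) (B : Finset V) (f : Strategy V) (n t : ℕ)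
    (ω : ℕ → Config V) :
    survival G lam B f (n + 1) t ω ≤
      ∫⁻ ζ, survival G lam B f n (t + 1) (Function.update ω (t + 1) ζ)
        ∂stepLaw G lam B (ω t) (f.choose t (fun j => ω j)) := by
  have hsub : survivalSet f (n + 1) t ⊆ survivalSet f n (t + 1) :=
    fun X hX i h1 h2 => hX i (by omega) (by omega)
  refine (measure_mono hsub).trans (le_of_eq ?_)
  rw [← lintegral_indicator_one (measurableSet_survivalSet f n (t + 1)),
    lintegral_trajFrom_succ _ _ _ (measurable_one.indicator (measurableSet_survivalSet f n _))]
  refine lintegral_congr fun ζ => ?_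
  exact lintegral_indicator_one (measurableSet_survivalSet f n (t + 1))

theorem lintegral_toppleLaw (lam : ℝ≥0) (B : Finset V) (ζ : Config V) (x : V)
    (F : Config V → ℝ≥0∞) :
    ∫⁻ ξ, F ξ ∂toppleLaw G lam B ζ x =
      sleepProb lam B ζ x * F (Function.update ζ x slp) +
        (1 - sleepProb lam B ζ x : ℝ≥0) * ∫⁻ X, F (walkResult B ζ x X) ∂walkLaw G x := by
  rw [toppleLaw, lintegral_add_measure, lintegral_smul_measure, lintegral_smul_measure,
    lintegral_dirac, lintegral_map (measurable_of_countable F) (measurable_walkResult B ζ x)]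
  rfl

/-- One ARWD step is matched with no sandpile toppling if the particle falls asleep, and with a
whole excursion from `x` if it walks. The new active set and its parity law then satisfy the same
hypotheses with `k` lowered by one. -/
theorem survival_le_avg_gameVal {A B : Finset V} (hBA : B ⊆ A) (hBdeg : ∀ x ∈ B, 2 ≤ G.degree x)
    (hBdisc : ∀ x ∈ B, ∀ y ∈ B, ¬ G.Adj x y) {lam : ℝ≥0} (hlam : lam = (G.maxDegree : ℝ≥0) ^ 3)
    (hΔ : 1 ≤ G.maxDegree) (f : Strategy V) (k : ℕ) (t : ℕ) (ω : ℕ → Config V)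
    (S : Finset V) (hS : S ⊆ B) (hω : ω t = stateConfig B S) (m : ℕ) (hm : m ≤ k - S.card)
    (a : V → Bool → ℝ≥0∞) (ha : IsParityLaw lam S a) :
    survival G lam B f k t ω ≤ avg a (gameVal G A B m (fullConfig A)) := by
  have hlam' : (lam : ℝ≥0∞) = (G.maxDegree : ℝ≥0∞) ^ 3 := by
    rw [hlam]; push_cast; rfl
  induction k generalizing t ω S m a with
  | zero =>
    obtain rfl : m = 0 := by omega
    have : gameVal G A B 0 (fullConfig A) = fun _ => 1 := rfl
    rw [this, avg_const ha.total]
    exact survival_le_one ..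
  | succ k ih =>
    rcases hf : f.choose t (fun j => ω j) with _ | x
    · rw [survival_succ_of_none hf]; exact zero_le
    have hxS : x ∈ S := by
      have hu := f.unstable t _ x hf
      simp only [hω] at hu
      by_contra hxS
      by_cases hxB : x ∈ B <;> simp [stateConfig, hxS, hxB, SiteState.Unstable] at hu
    have hxB := hS hxS
    set S₀ := S.erase x with hS₀
    have hS₀B : S₀ ⊆ B.erase x := Finset.erase_subset_erase x hS
    have hins : insert x S₀ = S := Finset.insert_erase hxS
    have hcard : S₀.card + 1 = S.card := Finset.card_erase_add_one hxS
    have hxS₀ : x ∉ S₀ := Finset.notMem_erase x S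
    set Φ : Config V → ℝ≥0∞ := fun ζ =>
      survival G lam B f k (t + 1) (Function.update ω (t + 1) ζ) with hΦ
    have hΦm : Measurable Φ := measurable_of_countable Φ
    have hΦ1 : ∀ ζ, Φ ζ ≤ 1 := fun ζ => survival_le_one ..
    have hΦS : ∀ S ⊆ B, ∀ n ≤ k - S.card, ∀ a, IsParityLaw lam S a →
        Φ (stateConfig B S) ≤ avg a (gameVal G A B n (fullConfig A)) := fun S hS n hn a ha =>
      ih (t + 1) _ S hS (by simp) n hn a ha
    set avgx : Bool → ℝ≥0∞ := fun b =>
      avg (Function.update a x (pt b)) (gameVal G A B m (fullConfig A)) with havgx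
    have hlaw : ∀ b, IsParityLaw lam S₀ (Function.update a x (pt b)) := fun b =>
      ha.update (by rw [Finset.insert_eq_of_mem hxS]; exact Finset.erase_subset _ _)
        (pt_total b) fun h => absurd h hxS₀
    have hsleep : ∀ b, Φ (stateConfig B S₀) ≤ avgx b := fun b =>
      hΦS S₀ (hS₀B.trans (Finset.erase_subset _ _)) m (by omega) _ (hlaw b)
    have hwalk : ∫⁻ X, Φ (walkResult B (stateConfig B S) x X) ∂walkLaw G x ≤ avgx true := by
      set ψ : (ℕ → V) → ℝ≥0∞ := fun X => Φ (walkResult B (stateConfig B S) x X) with hψ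
      have hψm : Measurable ψ := hΦm.comp (measurable_walkResult B _ x)
      -- The supremum over histories makes it unnecessary to show that the integral depends on `(w,
      -- S')` only; unreachable pairs get the value `0`.
      set U : V → Finset V → ℝ≥0∞ := fun w S' =>
        ⨆ (s : ℕ) (X : ℕ → V) (_ : IsExcursion B S₀ x s X w S'),
          ∫⁻ Y, ψ Y ∂trajFrom (walkKernel G) s X with hU
      have hleU : ∀ {s X w S'}, IsExcursion B S₀ x s X w S' →
          ∫⁻ Y, ψ Y ∂trajFrom (walkKernel G) s X ≤ U w S' := by
        intro s X w S' h
        exact le_iSup_of_le s (le_iSup₂_of_le X h le_rfl)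
      have hdeg : 0 < G.degree x := lt_of_lt_of_le two_pos (hBdeg x hxB)
      have hexc := excursion_le_avg_gameVal hBA hBdeg hBdisc hlam' hΔ hxB (k := k) (U := U)
        ?_ ?_ ?_
      · have h0 : walkLaw G x = trajFrom (walkKernel G) 0 fun _ => x := rfl
        rw [h0, lintegral_trajFrom_walkKernel G 0 _ hψm]
        refine le_trans (Finset.sum_le_sum fun z _ => ?_)
          (avg_sum_le_of_topplable G (x := x) ?_ m)
        · by_cases hz0 : jumpPMF G x z = 0
          · simp [hz0]
          have hadj := adj_of_jumpPMF_ne_zero G hdeg hz0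
          have hzB : z ∉ B := fun h => hBdisc x hxB z h hadj
          refine mul_le_mul_right ?_ _
          rw [avg_flip hxB a (gameVal G A B (m - 1) (move (fullConfig A) x z))]
          have hr : record B x S₀ z = S₀ := by simp [record, hzB]
          refine (hleU (IsExcursion.first B S₀ x z hadj.ne')).trans ?_
          rw [hr]
          refine hexc (m - 1) z S₀ hS₀B (fun h => absurd h hzB) ?_ _ ((hlaw _).mono
            (Finset.erase_subset _ _))
          have := Finset.card_le_card (Finset.erase_subset z S₀)
          omega
        · intro e he
          have hex : e x = true := by
            by_contra hne
            refine he x ?_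
            simp [pt, hne]
          exact Or.inr (Or.inr ⟨hxB, by simp [fullConfig, hBA hxB], hex⟩)
      · intro w S'
        refine iSup_le fun s => iSup₂_le fun X _ => ?_
        refine (lintegral_mono fun Y => hΦ1 _).trans ?_
        simp
      · intro w S' hw
        refine iSup_le fun s => iSup₂_le fun X hX => ?_
        rw [lintegral_trajFrom_walkKernel G s X hψm, hX.last]
        exact Finset.sum_le_sum fun z _ => mul_le_mul_right (hleU (hX.succ hw z)) _
      · intro S' hS' n hn a' ha'
        refine le_trans ?_ (hΦS S' (hS'.trans (Finset.erase_subset _ _)) n hn a' ha')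
        refine iSup_le fun s => iSup₂_le fun X hX => ?_
        have : ∀ᵐ Y ∂trajFrom (walkKernel G) s X, ψ Y = Φ (stateConfig B S') := by
          filter_upwards [ae_trajFrom (walkKernel G) s X] with Y hY
          have hYe : IsExcursion B S₀ x s Y x S' := by
            refine ⟨by rw [hY 0 (by omega), hX.start], hX.pos, fun i h1 h2 => ?_, ?_, fun v => ?_⟩
            · rw [hY i h2.le]; exact hX.ne i h1 h2
            · rw [hY s le_rfl, hX.last]
            · rw [hX.mem]
              refine or_congr_right (and_congr_right fun _ => and_congr_right fun _ =>
                exists_congr fun i => and_congr_right fun _ => and_congr_right fun hi => ?_)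
              rw [hY i hi]
          simp only [hψ]
          rw [← hins, hYe.walkResult_eq hxB hS₀B]
        rw [lintegral_congr_ae this]
        simp
    refine (survival_succ_le lam B f k t ω).trans ?_
    rw [hf, hω]
    simp only [stepLaw]
    rw [lintegral_toppleLaw, update_stateConfig hxB]
    have hsp : sleepProb lam B (stateConfig B S) x = lam / (1 + lam) := by
      rw [sleepProb, if_pos ⟨hxB, by simp [stateConfig, hxS]⟩]
    set p : ℝ≥0∞ := ((sleepProb lam B (stateConfig B S) x : ℝ≥0) : ℝ≥0∞) with hp
    set p' : ℝ≥0∞ := ((1 - sleepProb lam B (stateConfig B S) x : ℝ≥0) : ℝ≥0∞) with hp'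
    have hpp : p + p' = 1 := by
      rw [hp, hp', ← ENNReal.coe_add, add_tsub_cancel_of_le (sleepProb_le_one lam B _ x),
        ENNReal.coe_one]
    have hp'a : p' ≤ a x true := by
      have h1 : (1 - sleepProb lam B (stateConfig B S) x : ℝ≥0) * (1 + lam) = 1 := by
        rw [hsp, tsub_mul, div_mul_cancel₀ _ (by positivity), one_mul, add_tsub_cancel_right]
      have h2 : 1 ≤ (1 + (lam : ℝ≥0∞)) * a x true := by
        rw [add_mul, one_mul, add_comm, ← ha.total x]
        exact add_le_add_left (ha.odd x hxS) _
      calc p' = p' * 1 := (mul_one _).symm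
        _ ≤ p' * ((1 + (lam : ℝ≥0∞)) * a x true) := by gcongr
        _ = ((1 - sleepProb lam B (stateConfig B S) x : ℝ≥0) * (1 + lam) : ℝ≥0) * a x true := by
          rw [hp']; push_cast; ring
        _ = a x true := by rw [h1]; simp
    -- The parity at `x` may be odd more often than the particle walks. On the excess mass `d`, `x`
    -- is treated as asleep despite its odd parity, which `hsleep` allows.
    obtain ⟨d, hd⟩ := exists_add_of_le hp'a
    have hpd : p = a x false + d := by
      have h3 : p' + p = p' + (a x false + d) := by
        rw [add_comm, hpp, ← ha.total x, hd]; ring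
      exact (ENNReal.add_right_inj ENNReal.coe_ne_top).1 h3
    rw [avg_eq_sum a _ x, Fintype.sum_bool]
    change p * Φ (stateConfig B S₀) + p' * _ ≤ a x true * avgx true + a x false * avgx false
    calc p * Φ (stateConfig B S₀) + p' * ∫⁻ X, Φ (walkResult B (stateConfig B S) x X) ∂walkLaw G x
        ≤ (a x false * avgx false + d * avgx true) + p' * avgx true := by
          rw [hpd, add_mul]
          gcongr
          · exact hsleep _
          · exact hsleep _
      _ = _ := by rw [hd]; ring

end Sandpile

namespace Sandpile

open SiteState

/-! ### The game from the initial configuration -/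

section Initial

variable {V : Type*} [DecidableEq V] [Fintype V] {G : SimpleGraph V} [DecidableRel G.Adj]

theorem sum_loopKernel (A : Finset V) (c : V → ℕ) (y : V) : ∑ u, loopKernel G A c y u = 1 := by
  simp only [loopKernel]
  rw [Finset.sum_comm]
  refine (Finset.sum_congr rfl fun z _ => ?_).trans (sum_jumpPMF G y)
  rw [← Finset.mul_sum]
  split_ifs
  · rw [sum_jumpPMF, mul_one]
  · simp

theorem sum_move {c : V → ℕ} {x : V} (hx : 1 ≤ c x) (z : V) : ∑ v, move c x z v = ∑ v, c v := by
  have h : ∀ v, move c x z v + (if v = x then 1 else 0) = c v + if v = z then 1 else 0 := by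
    intro v
    rw [move_apply]
    by_cases hv : v = x
    · subst hv; simp; omega
    · simp [hv]
  have h2 := Finset.sum_congr (rfl : (Finset.univ : Finset V) = Finset.univ) fun v _ => h v
  simpa [Finset.sum_add_distrib] using h2

omit [Fintype V] in
theorem le_move {c : V → ℕ} {x z v : V} (h : v ≠ x) : c v ≤ move c x z v := by
  simp [move_apply, h]

theorem le_avg_flip {B : Finset V} {x : V} {a : V → Bool → ℝ≥0∞}
    (ha : ∀ y, a y false + a y true = 1) {g : (V → Bool) → ℝ≥0∞} {v : ℝ≥0∞}
    (h : ∀ b, v ≤ avg (Function.update a x (pt b)) g) : v ≤ avg a fun e => g (flip B e x) := by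
  rw [avg_eq_sum a _ x]
  calc v = (a x false + a x true) * v := by rw [ha, one_mul]
    _ = ∑ b, a x b * v := by simp; ring
    _ ≤ _ := by
      refine Finset.sum_le_sum fun b _ => mul_le_mul_right ?_ _
      by_cases hx : x ∈ B
      · rw [avg_flip hx]; exact h _
      · simp only [flip, if_neg hx]; exact h _

/-- `S` consists of the sites of `S₀` already toppled. Such a site keeps a neighbour that is
occupied or outside `A`, so its parity can be randomised by loops at each departure; no control is
needed while it holds two particles or more. -/
theorem le_avg_gameVal_of_card {A B : Finset V} (hBA : B ⊆ A) (hBdeg : ∀ x ∈ B, 2 ≤ G.degree x)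
    (hBdisc : ∀ x ∈ B, ∀ y ∈ B, ¬ G.Adj x y) {lam : ℝ≥0∞} (hlam : lam = (G.maxDegree : ℝ≥0∞) ^ 3)
    (hΔ : 1 ≤ G.maxDegree) {S₀ : Finset V} (hS₀ : S₀ ⊆ B) {k : ℕ} {v : ℝ≥0∞} (hv : v ≤ 1)
    (hfull : ∀ n ≤ k - S₀.card, ∀ a, IsParityLaw lam S₀ a →
      v ≤ avg a (gameVal G A B n (fullConfig A)))
    (n : ℕ) (c : V → ℕ) (hc : ∑ x, c x = A.card) (S : Finset V) (hS : S ⊆ S₀)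
    (hnew : ∀ y ∈ S₀, y ∉ S → 2 ≤ c y) (hold : ∀ y ∈ S, ∃ z, G.Adj y z ∧ (z ∉ A ∨ 1 ≤ c z))
    (hn : n ≤ k - S.card) (a : V → Bool → ℝ≥0∞) (hpt : ∀ y ∈ S₀, y ∉ S → a y = pt false)
    (ha : IsParityLaw lam (S.filter fun y => c y ≤ 1) a) :
    v ≤ avg a (gameVal G A B n c) := by
  have hlam1 : 1 ≤ lam := by
    rw [hlam]; exact one_le_pow₀ (by exact_mod_cast hΔ)
  induction n using Nat.strong_induction_on generalizing c S a with
  | _ n ih =>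
  rcases Nat.eq_zero_or_pos n with rfl | hn0
  · have : gameVal G A B 0 c = fun _ => 1 := rfl
    rw [this, avg_const ha.total]
    exact hv
  have hsum : ∀ x, v = ∑ z, jumpPMF G x z * v := fun x => by
    rw [← Finset.sum_mul, sum_jumpPMF, one_mul]
  -- sites with few particles after the move of a particle from `x`
  have hfilter : ∀ (S' : Finset V) (x z : V), S' ⊆ insert x S →
      (S'.filter fun y => move c x z y ≤ 1) ⊆ insert x (S.filter fun y => c y ≤ 1) := by
    intro S' x z hS' y hy
    rw [Finset.mem_filter] at hy
    by_cases hyx : y = x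
    · simp [hyx]
    · have := (Finset.mem_insert.1 (hS' hy.1)).resolve_left hyx
      exact Finset.mem_insert_of_mem (Finset.mem_filter.2 ⟨this, (le_move hyx).trans hy.2⟩)
  -- The witness `u` is not in `B`; if it lies in `A` and is toppled, it has two particles or more,
  -- so one remains.
  have hkeep : ∀ (x z : V), (x ∈ A → x ∉ B → 2 ≤ c x) → ∀ y ∈ S, ∃ u, G.Adj y u ∧
      (u ∉ A ∨ 1 ≤ move c x z u) := by
    intro x z hx y hy
    obtain ⟨u, hu, h⟩ := hold y hy
    refine ⟨u, hu, ?_⟩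
    rcases h with h | h
    · exact Or.inl h
    · by_cases hux : u = x
      · subst hux
        by_cases huA : u ∈ A
        · have := hx huA fun huB => hBdisc y (hS₀ (hS hy)) u huB hu
          right; rw [move_apply]; simp; omega
        · exact Or.inl huA
      · exact Or.inr (h.trans (le_move hux))
  -- Each site of `S₀` is first toppled once: its parity becomes odd, and the particle sent out
  -- provides the occupied neighbour, unless that neighbour is outside `A`.
  by_cases hSS : ∃ y ∈ S₀, y ∉ S
  · obtain ⟨y, hy, hyS⟩ := hSS
    have hyB := hS₀ hy
    have hdeg : 0 < G.degree y := lt_of_lt_of_le two_pos (hBdeg y hyB)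
    have hcy := hnew y hy hyS
    rw [hsum y]
    refine le_trans (Finset.sum_le_sum fun z _ => ?_)
      (avg_sum_le_of_topplable G (x := y) (fun e _ => Or.inl hcy) n)
    by_cases hz0 : jumpPMF G y z = 0
    · simp [hz0]
    have hadj := adj_of_jumpPMF_ne_zero G hdeg hz0
    refine mul_le_mul_right ?_ _
    have hay : a = Function.update a y (pt false) := by
      rw [← hpt y hy hyS, Function.update_eq_self]
    rw [hay, avg_flip hyB a (gameVal G A B (n - 1) (move c y z))]
    refine ih (n - 1) (by omega) _ (by rw [sum_move (by omega), hc]) (insert y S)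
      (Finset.insert_subset hy hS) ?_ ?_ ?_ _ ?_ ?_
    · intro y' hy' hyS'
      rw [Finset.mem_insert, not_or] at hyS'
      exact (hnew y' hy' hyS'.2).trans (le_move hyS'.1)
    · intro y' hy'
      rcases Finset.mem_insert.1 hy' with rfl | hy'
      · exact ⟨z, hadj, Or.inr (by simp [move_apply])⟩
      · exact hkeep y z (fun _ h => absurd hyB h) y' hy'
    · rw [Finset.card_insert_of_notMem hyS]; omega
    · intro y' hy' hyS'
      rw [Finset.mem_insert, not_or] at hyS'
      rw [Function.update_of_ne hyS'.1]
      exact hpt y' hy' hyS'.2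
    · exact ha.update (hfilter _ y z subset_rfl) (pt_total _) fun _ => by simp [pt]
  have hSe : S = S₀ := hS.antisymm fun y hy => by
    by_contra h; exact hSS ⟨y, hy, h⟩
  subst hSe
  by_cases hex : ∃ w, 2 ≤ c w ∨ (w ∉ A ∧ 1 ≤ c w)
  · obtain ⟨w, hw⟩ := hex
    have hw1 : 1 ≤ c w := by omega
    by_cases hwS : w ∈ S
    · have hwB := hS₀ hwS
      have hcw : 2 ≤ c w := hw.resolve_right fun h => h.1 (hBA hwB)
      have hdeg : 0 < G.degree w := lt_of_lt_of_le two_pos (hBdeg w hwB)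
      obtain ⟨z, hz, hzg⟩ := hold w hwS
      refine le_avg_gameVal_of_loop G (W := fun _ => v) hlam1 hwB hdeg
        (fun z hz hzB => hBdisc w hwB z hzB hz) hcw
        (hlam ▸ one_le_mul_loopKernel G hz hzg) (ha.total w)
        (ne_top_of_le_ne_top ENNReal.one_ne_top hv) ?_ ?_ ?_
      · rw [← Finset.sum_mul, sum_loopKernel, one_mul]
      · intro b
        refine ih (n - 1) (by omega) c hc S hS hnew hold (by omega) _
          (fun y hy hyS => absurd hy hyS) ?_
        exact ha.update (Finset.subset_insert _ _) (pt_total b) fun h => by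
          have := (Finset.mem_filter.1 h).2
          omega
      · intro u hu q hq1 hq2
        refine ih (n - 1) (by omega) _ (by rw [sum_move hw1, hc]) S hS
          (fun y hy hyS => absurd hy hyS) (hkeep w u fun _ h => absurd hwB h) (by omega) _
          (fun y hy hyS => absurd hy hyS) ?_
        exact ha.update (hfilter S w u (Finset.subset_insert _ _)) hq1 fun _ => hq2
    · rw [hsum w]
      refine le_trans (Finset.sum_le_sum fun z _ => mul_le_mul_right ?_ _)
        (avg_sum_le_of_topplable G (x := w) (fun e _ => ?_) n)
      · refine le_avg_flip ha.total fun b => ?_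
        refine ih (n - 1) (by omega) _ (by rw [sum_move hw1, hc]) S hS
          (fun y hy hyS => absurd hy hyS) (hkeep w z fun h _ => ?_) (by omega) _
          (fun y hy hyS => absurd hy hyS) ?_
        · exact hw.resolve_right fun h' => h'.1 h
        · exact ha.update (hfilter S w z (Finset.subset_insert _ _)) (pt_total b) fun h =>
            absurd (Finset.mem_filter.1 h).1 hwS
      · rcases hw with hw | hw
        · exact Or.inl hw
        · exact Or.inr (Or.inl hw)
  · push Not at hex
    -- Nothing is left to level, and the total `A.card` forces one particle on every site of `A`.
    have hle : ∀ x ∈ (Finset.univ : Finset V), c x ≤ fullConfig A x := by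
      intro x _
      have := hex x
      by_cases hxA : x ∈ A
      · simp only [fullConfig, if_pos hxA]; omega
      · have := this.2 hxA
        omega
    have hcard : ∑ x, fullConfig A x = A.card := by simp [fullConfig]
    have heq := (Finset.sum_eq_sum_iff_of_le hle).1 (hc.trans hcard.symm)
    have hcA : c = fullConfig A := funext fun x => heq x (Finset.mem_univ x)
    rw [hcA]
    refine hfull n hn a (ha.mono fun y hy => Finset.mem_filter.2 ⟨hy, ?_⟩)
    have := (hex y).1
    omega

end Initial

/-! ### Initial active set, stabilisation time and conclusion -/

theorem restrict_inducedConfig {V : Type*} [DecidableEq V] {A B : Finset V} (hBA : B ⊆ A)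
    (η : V → ℕ) :
    (inducedConfig A η).restrict B = stateConfig B (B.filter fun x => 2 ≤ η x) := by
  funext x
  by_cases hx : x ∈ B
  · simp [Config.restrict, inducedConfig, stateConfig, hx, hBA hx]
  · simp [Config.restrict, stateConfig, hx]

theorem setOf_le_stabTime_subset {V : Type*} [Fintype V] (f : Strategy V) (n : ℕ) :
    {ω | (n : ℕ∞) ≤ stabTime f ω} ⊆ survivalSet f n 0 := by
  intro ω hω i _ hi h
  have h1 : (n : ℕ∞) ≤ stabTime f ω := hω
  have h2 : stabTime f ω ≤ i := iInf₂_le i h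
  have h3 : n ≤ i := by exact_mod_cast h1.trans h2
  omega

end Sandpile

end

open Sandpile in
theorem mainTheorem3 {V : Type*} [Fintype V] [DecidableEq V]
    [MeasurableSpace V] [DiscreteMeasurableSpace V]
    (G : SimpleGraph V) [DecidableRel G.Adj] (hG : G.Connected) (hΔ : 2 ≤ G.maxDegree)
    (A B : Finset V) (hBA : B ⊆ A)
    (hBdeg : ∀ x ∈ B, 2 ≤ G.degree x)
    (hBdisc : ∀ x ∈ B, ∀ y ∈ B, ¬ G.Adj x y)
    (η : V → ℕ) (hη : ∑ x, η x = A.card)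
    (f : Strategy V) :
    StochDominates (instructionLaw G) (numHalfTopplings A η)
      (arwdLaw G ((G.maxDegree : NNReal) ^ 3) B f ((inducedConfig A η).restrict B))
      (stabTime f) := by
  refine stochDominates_of_le_gameVal G A B η _ _ fun n => ?_
  rw [restrict_inducedConfig hBA]
  set S₀ := B.filter fun x => 2 ≤ η x with hS₀
  refine (measure_mono (setOf_le_stabTime_subset f n)).trans ?_
  change survival G _ B f n 0 (fun _ => stateConfig B S₀) ≤ _
  have hS₀B : S₀ ⊆ B := Finset.filter_subset _ _
  have key := le_avg_gameVal_of_card hBA hBdeg hBdisc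
    (lam := (((G.maxDegree : NNReal) ^ 3 : NNReal) : ENNReal)) (by push_cast; rfl) (by omega)
    hS₀B (k := n) (survival_le_one G ((G.maxDegree : NNReal) ^ 3) B f n 0
      (fun _ => stateConfig B S₀))
    (fun m hm a ha => survival_le_avg_gameVal hBA hBdeg hBdisc rfl (by omega) f n 0 _ S₀ hS₀B rfl
      m hm a ha)
    n η hη ∅ (Finset.empty_subset _) (fun y hy _ => (Finset.mem_filter.1 hy).2) (by simp)
    (by simp) (fun _ => pt false) (fun _ _ _ => rfl) ⟨fun _ => pt_total false, by simp⟩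
  refine key.trans ?_
  -- All initial parities are even, so the average charges only the zero parity field.
  rw [← avg_const (a := fun _ : V => pt false) (fun _ => pt_total false)
    (gameVal G A B n η fun _ => false)]
  refine avg_mono fun e he => le_of_eq ?_
  congr 1
  funext y
  by_contra hy
  exact he y (by simp [pt, hy])
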